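/- Let $p$ be a prime, $q=p^e$ with $e\ge 1$, and let $f(T)\in\mathbb Z[T]$ be a $q$-Weil polynomial of degree $4$, i.e. a monic polynomial whose complex roots can be ordered as $\alpha_1,\dots,\alpha_4$ with $\alpha_1\alpha_3=\alpha_2\alpha_4=q$ and $|\alpha_j|=\sqrt q$ for all $j$. Assume that * (ordinary) the coefficient of $T^2$ in $f$ is prime to $p$; * (Galois) $f$ is irreducible over $\mathbb Q$, and $K=\mathbb Q[T]/(f(T))$ is Galois over $\mathbb Q$ and unramified at $p$; * (maximal) if $\varpi$ denotes a root of $f$, with complex conjugate $\bar\varpi$, then $\mathbb Z[\varpi,\bar\varpi]$ is the full ring of integers $\mathcal O_K$. Then $K$ is a CM field with an intrinsic complex conjugation $a\mapsto\bar a$; let $K^+$ be its maximal totally real subfield. Let $\ell\ne p$ be a prime and $\kappa(\ell)=\mathcal O_K\otimes\mathbb F_\ell$, a four-dimensional $\mathbb F_\ell$-vector space. There is a symplectic (alternating, nondegenerate) pairing $\langle\cdot,\cdot\rangle$ on $\kappa(\ell)$ with $\langle ax,y\rangle=\langle x,\bar a y\rangle$ for all $a\in\mathcal O_K$. Choose any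 such pairing and any symplectic basis; multiplication by $\varpi$ on $\kappa(\ell)$ then becomes an element $\gamma_\ell\in \mathrm{GSp}_4(\mathbb F_\ell)$ of multiplier $q$. Call $\gamma\in\mathrm{GSp}_4(\mathbb F_\ell)$ cyclic if $\{\gamma^i v: i\ge 0\}$ spans $\mathbb F_\ell^4$ for some $v$, write $\gamma_{ss}$ for the semisimple part of $\gamma$ in its Jordan decomposition, and let $\mathrm{GSp}_4(\mathbb F_\ell)^{(q)}$ be the set of elements of multiplier $q$. Put $$\nu_\ell(f)=\frac{\#\{\gamma\in \mathrm{GSp}_4(\mathbb F_\ell):\ \gamma \text{ is cyclic and } \gamma_{ss} \text{ is } \mathrm{GSp}_4(\mathbb F_\ell)\text{-conjugate to } (\gamma_\ell)_{ss}\}}{\#\mathrm{GSp}_4(\mathbb F_\ell)^{(q)}/\ell^2}.$$ For a character $\chi:\mathrm{Gal}(K/\mathbb Q)\to\mathbb C^\times$ let $K^\chi$ be the fixed field of $\ker\chi$; let $\chi(\ell)=\chi(\mathrm{Frob}_{K^\chi}(\ell))$ if $\ell$ is unramified in $K^\chi$, and $\chi(\ell)=0$ otherwise. Let $S(K)$ be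 the set of characters of $\mathrm{Gal}(K/\mathbb Q)$ that do not factor through $\mathrm{Gal}(K^+/\mathbb Q)$, and put $$\nu_\ell(K)=\prod_{\chi\in S(K)}\frac{1}{1-\chi(\ell)/\ell}.$$ Then, for every prime $\ell\neq p$ and every choice of the pairing and the symplectic basis, $\nu_\ell(f)=\nu_\ell(K)$. -/

import Mathlib

open Polynomial NumberField TensorProduct

noncomputable section

namespace WeilSurface

/-! ### Quartic Weil polynomials -/

/-- `f` is a `q`-Weil polynomial of degree `4`: it is a monic integral quartic whose complex roots
`α₀, α₁, β₀, β₁` satisfy `αⱼ * βⱼ = q` and all have absolute value `√q`. -/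
def IsWeilQuartic (q : ℕ) (f : ℤ[X]) : Prop :=
  f.Monic ∧ f.natDegree = 4 ∧
    ∃ α β : Fin 2 → ℂ,
      f.map (Int.castRingHom ℂ) = ∏ j, (X - C (α j)) * (X - C (β j)) ∧
      (∀ j, α j * β j = q) ∧ ∀ j, ‖α j‖ = √(q : ℝ) ∧ ‖β j‖ = √(q : ℝ)

/-- The rational prime `ℓ` is unramified in the number field `L`. -/
def IsUnramifiedIn (L : Type*) [Field L] [NumberField L] (ℓ : ℕ) : Prop :=
  ∀ (P : Ideal (𝓞 L)) [P.IsPrime], P.LiesOver (Ideal.span {(ℓ : ℤ)}) → Algebra.IsUnramifiedAt ℤ P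

/-- `(K, ϖ)` is the field `ℚ[T]/(f)` together with the class of `T`. -/
def IsRootField (f : ℤ[X]) (K : Type*) [Field K] [NumberField K] (ϖ : K) : Prop :=
  aeval ϖ f = 0 ∧ IntermediateField.adjoin ℚ {ϖ} = ⊤

/-- The order `ℤ[ϖ, ϖ̄]` is the maximal order of `K`, where `ϖ` is viewed as a complex number
through any complex embedding `φ` of `K`, and the maximal order as a subring of `ℂ`. -/
def IsMaximalWeil (K : Type*) [Field K] [NumberField K] (ϖ : K) : Prop :=
  ∀ φ : K →+* ℂ, Algebra.adjoin ℤ {φ ϖ, starRingEnd ℂ (φ ϖ)} =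
    (integralClosure ℤ K).map φ.toIntAlgHom

/-- The hypotheses on `f`: it is a `q`-Weil polynomial of degree `4`, where `q` is a power of `p`,
which is ordinary, irreducible, with `K = ℚ[T]/(f)` unramified at `p`, and maximal. (That `K` is
Galois over `ℚ` is a separate hypothesis.) -/
structure IsAdmissible (p q : ℕ) (f : ℤ[X]) (K : Type*) [Field K] [NumberField K] (ϖ : K) :
    Prop where
  primePow : ∃ e : ℕ, e ≠ 0 ∧ q = p ^ e
  weil : IsWeilQuartic q f
  ordinary : IsCoprime (f.coeff 2) (p : ℤ)
  irreducible : Irreducible (f.map (Int.castRingHom ℚ))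
  rootField : IsRootField f K ϖ
  unramified : IsUnramifiedIn K p
  maximal : IsMaximalWeil K ϖ

/-! ### The symplectic similitude group `GSp₄` -/

/-- The standard symplectic form on `k⁴`. -/
def J (k : Type*) [Field k] : Matrix (Fin 2 ⊕ Fin 2) (Fin 2 ⊕ Fin 2) k :=
  Matrix.fromBlocks 0 1 (-1) 0

/-- `GSp₄(k)⁽ᵐ⁾`: the symplectic similitudes of multiplier `m`. -/
def GSpMult (k : Type*) [Field k] (m : k) : Set (GL (Fin 2 ⊕ Fin 2) k) :=
  {γ | γ.1.transpose * J k * γ.1 = m • J k}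

/-- `GSp₄(k)`: automorphisms of `k⁴` which preserve the standard symplectic form up to a
multiplier in `kˣ`. -/
def GSp (k : Type*) [Field k] : Set (GL (Fin 2 ⊕ Fin 2) k) :=
  {γ | ∃ m : kˣ, γ ∈ GSpMult k (m : k)}

/-- `γ` is cyclic: some vector `v` has the property that the `γ ^ i v`, `i ≥ 0`, span `k⁴`. -/
def IsCyclicElt {k : Type*} [Field k] (γ : GL (Fin 2 ⊕ Fin 2) k) : Prop :=
  ∃ v : Fin 2 ⊕ Fin 2 → k,
    Submodule.span k (Set.range fun i : ℕ => (γ.1 ^ i).mulVec v) = ⊤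

/-- `s` is the semisimplification (semisimple Jordan component) of `γ`: it is semisimple, commutes
with `γ`, and `γ - s` is nilpotent. -/
def IsSemisimplification {k : Type*} [Field k] (γ s : GL (Fin 2 ⊕ Fin 2) k) : Prop :=
  Module.End.IsSemisimple (Matrix.toLin' s.1) ∧ Commute s γ ∧ IsNilpotent (γ.1 - s.1)

/-- The semisimplifications of `γ` and `δ` are conjugate under `GSp₄(k)`. -/
def SameSemisimplification {k : Type*} [Field k] (γ δ : GL (Fin 2 ⊕ Fin 2) k) : Prop :=
  ∃ s t : GL (Fin 2 ⊕ Fin 2) k, IsSemisimplification γ s ∧ IsSemisimplification δ t ∧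
    ∃ h ∈ GSp k, h * s * h⁻¹ = t

/-! ### The element `γ_ℓ` -/

section Frobenius

variable (K : Type*) [Field K] [NumberField K] (ℓ : ℕ) [Fact ℓ.Prime]

/-- `κ(ℓ) = 𝓞_K ⊗ 𝔽_ℓ`. -/
abbrev Kappa : Type _ := ZMod ℓ ⊗[ℤ] 𝓞 K

/-- `B` is a symplectic (alternating and nondegenerate) pairing on `κ(ℓ)` with respect to which
the adjoint of (multiplication by) `a` is the complex conjugate of `a`. -/
def IsConjSymplectic (B : LinearMap.BilinForm (ZMod ℓ) (Kappa K ℓ)) : Prop :=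
  B.IsAlt ∧ B.Nondegenerate ∧
    ∃ ι : K ≃ₐ[ℚ] K, (∀ φ : K →+* ℂ, ComplexEmbedding.IsConj φ ι) ∧
      ∀ (a : 𝓞 K) (x y : Kappa K ℓ),
        B ((1 ⊗ₜ[ℤ] a) * x) y = B x ((1 ⊗ₜ[ℤ] (ι • a)) * y)

variable {K ℓ}

/-- `b` is a symplectic basis of `κ(ℓ)` for `B`; it identifies `GSp(κ(ℓ), B)` with
`GSp₄(𝔽_ℓ)`. -/
def IsSymplecticBasis (B : LinearMap.BilinForm (ZMod ℓ) (Kappa K ℓ))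
    (b : Module.Basis (Fin 2 ⊕ Fin 2) (ZMod ℓ) (Kappa K ℓ)) : Prop :=
  ∀ i j, B (b i) (b j) = J (ZMod ℓ) i j

/-- `γ` is the matrix, in the basis `b`, of the action of `ϖ` on `κ(ℓ)`. -/
def IsFrobMatrix (ϖ : K) (b : Module.Basis (Fin 2 ⊕ Fin 2) (ZMod ℓ) (Kappa K ℓ))
    (γ : GL (Fin 2 ⊕ Fin 2) (ZMod ℓ)) : Prop :=
  ∃ w : 𝓞 K, (w : K) = ϖ ∧
    γ.1 = LinearMap.toMatrix b b (LinearMap.mulLeft (ZMod ℓ) ((1 : ZMod ℓ) ⊗ₜ[ℤ] w))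

end Frobenius

/-- `ν_ℓ(f)`, where `γ_ℓ ∈ GSp₄(𝔽_ℓ)` is the matrix of the action of a root of `f` on `κ(ℓ)`. -/
def nuF (ℓ : ℕ) [Fact ℓ.Prime] (q : ℕ) (γℓ : GL (Fin 2 ⊕ Fin 2) (ZMod ℓ)) : ℚ :=
  (Set.ncard {γ : GL (Fin 2 ⊕ Fin 2) (ZMod ℓ) |
      γ ∈ GSp (ZMod ℓ) ∧ IsCyclicElt γ ∧ SameSemisimplification γ γℓ} : ℚ) /
    ((Set.ncard (GSpMult (ZMod ℓ) (q : ZMod ℓ)) : ℚ) / (ℓ : ℚ) ^ 2)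

/-! ### The local factor of `K` -/

section Field

variable {K : Type*} [Field K] [NumberField K]

/-- The field `K^χ` cut out by the character `χ`. -/
abbrev charField (χ : (K ≃ₐ[ℚ] K) →* ℂˣ) : IntermediateField ℚ K :=
  IntermediateField.fixedField χ.ker

/-- The restriction of `σ` to `E` is a Frobenius element of `Gal(E/ℚ)` over `ℓ`. -/
def RestrictsToFrob (E : IntermediateField ℚ K) (ℓ : ℕ) (σ : K ≃ₐ[ℚ] K) : Prop :=
  ∃ τ : E ≃ₐ[ℚ] E, (∀ x : E, (τ x : K) = σ x) ∧
    ∃ Q : Ideal (𝓞 E), Q.IsPrime ∧ Q.LiesOver (Ideal.span {(ℓ : ℤ)}) ∧ IsArithFrobAt ℤ τ Q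

theorem exists_restrictsToFrob [IsGalois ℚ K] (χ : (K ≃ₐ[ℚ] K) →* ℂˣ) (ℓ : ℕ)
    [hℓ : Fact ℓ.Prime] : ∃ σ, RestrictsToFrob (charField χ) ℓ σ := by
  have : IsGalois ℚ (charField χ) := IsGalois.of_fixedField_normal_subgroup χ.ker
  have hpr : (Ideal.span {(ℓ : ℤ)}).IsPrime := by
    rw [Ideal.span_singleton_prime (by exact_mod_cast hℓ.out.ne_zero)]
    exact Nat.prime_iff_prime_int.mp hℓ.out
  have hmax : (Ideal.span {(ℓ : ℤ)}).IsMaximal :=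
    hpr.isMaximal (by simpa using hℓ.out.ne_zero)
  obtain ⟨Q, hQ, hlies⟩ :=
    Ideal.exists_maximal_ideal_liesOver_of_isIntegral (S := 𝓞 (charField χ))
      (Ideal.span {(ℓ : ℤ)})
  have hbot : Q ≠ ⊥ :=
    Ideal.ne_bot_of_liesOver_of_ne_bot (p := Ideal.span {(ℓ : ℤ)})
      (by simpa using hℓ.out.ne_zero) Q
  have : Finite (𝓞 (charField χ) ⧸ Q) := Ideal.finiteQuotientOfFreeOfNeBot Q hbot
  obtain ⟨τ, hτ⟩ := IsArithFrobAt.exists_of_isInvariant ℤ (charField χ ≃ₐ[ℚ] charField χ) Q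
  obtain ⟨σ, hσ⟩ := AlgEquiv.restrictNormalHom_surjective (K₁ := charField χ) K τ
  refine ⟨σ, τ, fun x => ?_, Q, hQ.isPrime, hlies, hτ⟩
  rw [← hσ]
  exact AlgEquiv.restrictNormal_commutes σ (charField χ) x

open Classical in
/-- `χ(ℓ)`: the value of `χ` on the Frobenius at `ℓ` of `K^χ` if `ℓ` is unramified in `K^χ`, and
`0` otherwise. -/
def charValue [IsGalois ℚ K] (χ : (K ≃ₐ[ℚ] K) →* ℂˣ) (ℓ : ℕ) [Fact ℓ.Prime] : ℂ :=
  if IsUnramifiedIn (charField χ) ℓ then (χ (exists_restrictsToFrob χ ℓ).choose : ℂ) else 0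

variable (K) in
/-- `S(K)`: the characters of `Gal(K/ℚ)` which do not factor through `Gal(K⁺/ℚ)`, i.e. are
nontrivial on `Gal(K/K⁺)`, where `K⁺` is the maximal totally real subfield. -/
def imagChars : Set ((K ≃ₐ[ℚ] K) →* ℂˣ) :=
  {χ | ¬ ∀ σ : K ≃ₐ[ℚ] K, (∀ x ∈ maximalRealSubfield K, σ x = x) → χ σ = 1}

variable (K) in
/-- `ν_ℓ(K)`. -/
def nuK [IsGalois ℚ K] (ℓ : ℕ) [Fact ℓ.Prime] : ℂ :=
  ∏ᶠ χ ∈ imagChars K, (1 - charValue χ ℓ / (ℓ : ℂ))⁻¹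

end Field

end WeilSurface

end

/-!
Complex conjugation makes `𝓞_K = ℤ[ϖ, ϖ̄]` a quadratic algebra over `𝓞_{K⁺}`, with norm `z ↦ z z̄`,
so that `A = κ(ℓ)` is `R[ω] / (ω² - s ω + q)`, where `R = 𝓞_{K⁺} ⊗ 𝔽_ℓ` is generated by the
reduction `s` of `ϖ + ϖ̄`. The admissible pairings on `A` are the `μ(det(x, y))`, where `det` is the
determinant over `R` and `μ` is a linear form on `R` for which `(r, r') ↦ μ(r r')` is nondegenerate.

A cyclic element whose semisimple part is conjugate to that of `ω` has the characteristic polynomial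
of `ω`, hence is `φ ω φ⁻¹` for a linear automorphism `φ` of `A`, which is unique up to `Aˣ`.
Such a conjugate is a similitude of multiplier `q` exactly when `φ` transports the pairing to one of
the admissible ones. These form an `Rˣ`-torsor, so there are `#GSp₄(𝔽_ℓ)⁽q⁾ · #Rˣ` such `φ`.
Conversely all their `φ ω φ⁻¹` have semisimple parts conjugate to that of `ω` under similitudes: a
suitable power of `ω` lies in `R` where the discriminant `s² - 4q` of `A` over `R` is nilpotent, and
where the discriminant is invertible the norm `Aˣ → Rˣ` is surjective.

Hence `ν_ℓ(f) = ℓ² · #Rˣ / #Aˣ`. This is the ratio of the Euler factors at `ℓ` of `K` and `K⁺`, and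
by the factorisation of the zeta function of an abelian field these factors are products over the
characters of the Galois group.
-/

noncomputable section

namespace WeilSurface

open QuadraticAlgebra

/-! ### Norms from quadratic algebras over finite rings -/

section Norm

theorem exists_norm_eq_of_field {F : Type*} [Field F] [Finite F] {a b : F}
    (hd : b ^ 2 + 4 * a ≠ 0) (u : F) : ∃ z : QuadraticAlgebra F a b, norm z = u := by
  have := Fintype.ofFinite F
  by_cases h2 : ringChar F = 2
  · obtain ⟨x, rfl⟩ := FiniteField.isSquare_of_char_two h2 u
    exact ⟨⟨x, 0⟩, by simp [norm_def]⟩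
  · obtain ⟨x, y, h⟩ := FiniteField.exists_root_sum_quadratic (f := X ^ 2 - C u)
      (g := C (-(b ^ 2 + 4 * a)) * X ^ 2) (degree_X_pow_sub_C two_pos u)
      (degree_C_mul_X_pow 2 (neg_ne_zero.mpr hd))
      (by have := mt FiniteField.even_card_iff_char_two.mpr h2; lia)
    simp only [eval_sub, eval_pow, eval_X, eval_C, eval_mul] at h
    -- completing the square: `norm ⟨x - b y, 2 y⟩ = x ^ 2 - (b ^ 2 + 4 a) y ^ 2`
    exact ⟨⟨x - b * y, 2 * y⟩, by rw [norm_def]; linear_combination h⟩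

variable {R : Type*} [CommRing R] {a b : R}

theorem exists_isNilpotent_norm_sub [Finite R] (hd : IsUnit (b ^ 2 + 4 * a)) (u : R) :
    ∃ z : QuadraticAlgebra R a b, IsNilpotent (norm z - u) := by
  have residue (I : MaximalSpectrum R) : ∃ x y : R,
      x * x + b * x * y - a * y * y - u ∈ I.asIdeal := by
    let := Ideal.Quotient.field I.asIdeal
    let π := Ideal.Quotient.mk I.asIdeal
    have hdI : π b ^ 2 + 4 * π a ≠ 0 := by
      simpa [map_ofNat] using (hd.map π).ne_zero
    have : Finite (R ⧸ I.asIdeal) := Finite.of_surjective π Ideal.Quotient.mk_surjective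
    obtain ⟨z, hz⟩ := exists_norm_eq_of_field hdI (π u)
    obtain ⟨x, hx⟩ := Ideal.Quotient.mk_surjective z.re
    obtain ⟨y, hy⟩ := Ideal.Quotient.mk_surjective z.im
    refine ⟨x, y, Ideal.Quotient.eq_zero_iff_mem.mp ?_⟩
    rw [norm_def, ← hx, ← hy] at hz
    simpa [π, sub_eq_zero] using hz
  choose x y hxy using residue
  have coprime : Pairwise (Function.onFun IsCoprime fun I : MaximalSpectrum R => I.asIdeal) :=
    fun I I' h => Ideal.isCoprime_of_isMaximal fun h' => h (MaximalSpectrum.ext h')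
  obtain ⟨x₀, hx₀⟩ := Ideal.pi_quotient_surjective coprime fun I => Ideal.Quotient.mk _ (x I)
  obtain ⟨y₀, hy₀⟩ := Ideal.pi_quotient_surjective coprime fun I => Ideal.Quotient.mk _ (y I)
  refine ⟨⟨x₀, y₀⟩, nilpotent_iff_mem_prime.mpr fun I hI => ?_⟩
  let I' : MaximalSpectrum R := ⟨I, (IsArtinianRing.isPrime_iff_isMaximal I).mp hI⟩
  have h := Ideal.Quotient.eq_zero_iff_mem.mpr (hxy I')
  simp only [map_sub, map_add, map_mul, ← hx₀ I', ← hy₀ I'] at h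
  refine Ideal.Quotient.eq_zero_iff_mem.mp (Eq.trans ?_ h)
  simp only [norm_def, map_sub, map_add, map_mul, I']

theorem exists_norm_eq_of_isNilpotent_norm_sub (hd : IsUnit (b ^ 2 + 4 * a)) {u : R}
    (hu : IsUnit u) {v : QuadraticAlgebra R a b} (hv : IsNilpotent (norm v - u)) :
    ∃ w : QuadraticAlgebra R a b, norm w = u := by
  have hnv : IsUnit (norm v) := by
    simpa using hv.isUnit_add_left_of_commute hu (Commute.all _ _)
  let z : QuadraticAlgebra R a b := ⟨2 * a, b⟩
  -- `z` has trace `b ^ 2 + 4 a`, so that Newton's method solves `norm (v * (1 + t z)) = u` for `t`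
  let P : R[X] := C (norm v) * (1 + C (b ^ 2 + 4 * a) * X + C (norm z) * X ^ 2) - C u
  obtain ⟨t, ⟨-, ht⟩, -⟩ := existsUnique_nilpotent_sub_and_aeval_eq_zero (P := P) (x := (0 : R))
    (by simpa [P] using hv) (by simpa [P] using hnv.mul hd)
  refine ⟨v * ⟨1 + t * z.re, t * z.im⟩, ?_⟩
  simp only [P, aeval_sub, map_mul, map_add, map_one, map_pow, aeval_X, aeval_C,
    Algebra.algebraMap_self, RingHom.id_apply] at ht
  rw [map_mul, ← sub_eq_zero, ← ht]
  simp only [norm_def, z]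
  ring

theorem exists_norm_eq [Finite R] (hd : IsUnit (b ^ 2 + 4 * a)) {u : R} (hu : IsUnit u) :
    ∃ v : QuadraticAlgebra R a b, norm v = u :=
  let ⟨_, hv⟩ := exists_isNilpotent_norm_sub hd u
  exists_norm_eq_of_isNilpotent_norm_sub hd hu hv

theorem exists_mul_norm_eq [Finite R] {n : ℕ} (hn : n ≠ 0)
    (he : IsIdempotentElem ((b ^ 2 + 4 * a) ^ n)) {u : R} (hu : IsUnit u) :
    ∃ v : QuadraticAlgebra R a b, (b ^ 2 + 4 * a) ^ n * norm v = (b ^ 2 + 4 * a) ^ n * u := by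
  set e := (b ^ 2 + 4 * a) ^ n with he_def
  -- pass to the factor of `R` on which `e = 1`, where the discriminant is invertible
  let π := Ideal.Quotient.mk (Ideal.span {1 - e})
  have hπe : π e = 1 := by
    rw [eq_comm, ← map_one π, Ideal.Quotient.eq]
    exact Ideal.mem_span_singleton_self _
  have hd : IsUnit (π b ^ 2 + 4 * π a) := by
    refine (isUnit_pow_iff hn).mp ?_
    convert isUnit_one
    simpa [he_def, map_ofNat] using hπe
  have : Finite (R ⧸ Ideal.span {1 - e}) := Finite.of_surjective π Ideal.Quotient.mk_surjective
  obtain ⟨v, hv⟩ := exists_norm_eq hd (hu.map π)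
  obtain ⟨x, hx⟩ := Ideal.Quotient.mk_surjective v.re
  obtain ⟨y, hy⟩ := Ideal.Quotient.mk_surjective v.im
  refine ⟨⟨x, y⟩, ?_⟩
  have hmem : norm (⟨x, y⟩ : QuadraticAlgebra R a b) - u ∈ Ideal.span {1 - e} := by
    rw [← Ideal.Quotient.eq, norm_def]
    simpa [norm_def, ← hx, ← hy, π] using hv
  obtain ⟨r, hr⟩ := Ideal.mem_span_singleton.mp hmem
  linear_combination e * hr - r * he.eq

theorem exists_isIdempotentElem_pow {M : Type*} [Monoid M] [Finite M] (x : M) :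
    ∃ n, n ≠ 0 ∧ IsIdempotentElem (x ^ n) := by
  let : TopologicalSpace M := ⊥
  have : DiscreteTopology M := ⟨rfl⟩
  obtain ⟨_, ⟨n, hn, rfl⟩, h⟩ := exists_idempotent_in_compact_subsemigroup
    (fun _ => continuous_of_discreteTopology) {y | ∃ n, n ≠ 0 ∧ x ^ n = y} ⟨x ^ 1, 1, by simp⟩
    (Set.toFinite _).isCompact
    (by
      rintro _ ⟨m, hm, rfl⟩ _ ⟨n, -, rfl⟩
      exact ⟨m + n, by lia, pow_add x m n⟩)
  exact ⟨n, hn, h⟩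

end Norm

/-! ### Powers of the generator in characteristic `p` -/

section CharP

variable {R : Type*} [CommRing R] {a b : R} (p : ℕ) [hp : Fact p.Prime] [CharP R p]

theorem im_pow_char (z : QuadraticAlgebra R a b) :
    (z ^ p).im = z.im ^ p * ((ω : QuadraticAlgebra R a b) ^ p).im := by
  have := charP_of_injective_algebraMap
    (algebraMap_injective : Function.Injective (algebraMap R (QuadraticAlgebra R a b))) p
  have hz : z = algebraMap R _ z.re + z.im • ω := by
    ext <;> simp
  conv_lhs => rw [hz, add_pow_char, ← map_pow, _root_.smul_pow]
  rw [im_add, algebraMap_im, zero_add, im_smul, smul_eq_mul]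

theorem im_omega_pow_char_sq :
    ((ω : QuadraticAlgebra R a b) ^ p).im ^ 2 = (b ^ 2 + 4 * a) ^ (p - 1) := by
  rcases hp.out.eq_two_or_odd' with rfl | hodd
  · have h4 : (4 : R) = 0 := by linear_combination 2 * (CharTwo.two_eq_zero : (2 : R) = 0)
    rw [pow_two ω, omega_mul_omega_eq_add]
    simp [h4]
  · have h2 : IsUnit (2 : R) := mod_cast (CharP.isUnit_natCast_iff (n := 2) hp.out).mpr
      fun h => absurd ((Nat.prime_dvd_prime_iff_eq hp.out Nat.prime_two).mp h ▸ hodd) (by decide)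
    have hfrob : (2 : R) ^ p = 2 := map_ofNat (frobenius R p) 2
    obtain ⟨m, rfl⟩ := hodd
    -- the square root `2 ω - b` of the discriminant has `p`-th power `(b ^ 2 + 4 a) ^ m (2 ω - b)`
    let δ : QuadraticAlgebra R a b := ⟨-b, 2⟩
    have hδ : δ * δ = algebraMap R _ (b ^ 2 + 4 * a) := by
      ext
      · simp only [δ, re_mul, algebraMap_re]; ring
      · simp only [δ, im_mul, algebraMap_im]; ring
    have him := im_pow_char (2 * m + 1) δ
    rw [pow_succ, pow_mul, pow_two, hδ, ← map_pow, hfrob, ← Algebra.smul_def, im_smul,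
      smul_eq_mul] at him
    rw [h2.mul_left_cancel (him.symm.trans (mul_comm _ _)), ← pow_mul, mul_comm m,
      Nat.add_sub_cancel]

theorem im_omega_pow_dvd (M : ℕ) : ((ω : QuadraticAlgebra R a b) ^ p).im ^ M ∣
    ((ω : QuadraticAlgebra R a b) ^ p ^ M).im := by
  induction M with
  | zero => simp
  | succ M ih =>
    rw [pow_succ, pow_succ, pow_mul, im_pow_char p (ω ^ p ^ M)]
    exact mul_dvd_mul_right (ih.trans (dvd_pow_self _ hp.out.ne_zero)) _

theorem disc_pow_dvd_im_omega_pow {n M : ℕ} (h : 2 * n ≤ M) :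
    (b ^ 2 + 4 * a) ^ n ∣ ((ω : QuadraticAlgebra R a b) ^ p ^ M).im :=
  calc (b ^ 2 + 4 * a) ^ n ∣ ((b ^ 2 + 4 * a) ^ (p - 1)) ^ n :=
        pow_dvd_pow_of_dvd (dvd_pow_self _ (Nat.sub_ne_zero_of_lt hp.out.one_lt)) n
    _ = ((ω : QuadraticAlgebra R a b) ^ p).im ^ (2 * n) := by
        rw [← im_omega_pow_char_sq p, pow_mul]
    _ ∣ ((ω : QuadraticAlgebra R a b) ^ p).im ^ M := pow_dvd_pow _ h
    _ ∣ _ := im_omega_pow_dvd p M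

end CharP

/-! ### The forms `μ ∘ det` -/

section DetForm

variable {R : Type*} [CommRing R] {a b : R}

/-- The determinant of two elements of a quadratic algebra with respect to the basis `1, ω`. -/
def detForm : LinearMap.BilinForm R (QuadraticAlgebra R a b) :=
  LinearMap.mk₂ R (fun x y => x.re * y.im - y.re * x.im)
    (fun _ _ _ => by simp; ring) (fun _ _ _ => by simp; ring)
    (fun _ _ _ => by simp; ring) (fun _ _ _ => by simp; ring)

theorem detForm_apply (x y : QuadraticAlgebra R a b) :
    detForm x y = x.re * y.im - y.re * x.im := rfl

theorem detForm_mul_mul (v x y : QuadraticAlgebra R a b) :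
    detForm (v * x) (v * y) = norm v * detForm x y := by
  simp only [detForm_apply, norm_def, re_mul, im_mul]
  ring

theorem detForm_mul_left (z x y : QuadraticAlgebra R a b) :
    detForm (z * x) y = detForm x (star z * y) := by
  simp only [detForm_apply, re_mul, im_mul, re_star, im_star]
  ring

theorem eq_zero_of_detForm_eq_zero {x : QuadraticAlgebra R a b} (h : ∀ y, detForm x y = 0) :
    x = 0 := by
  have h1 := h 1
  have hω := h ω
  simp only [detForm_apply, re_one, im_one, omega_re, omega_im] at h1 hω
  ext
  · simpa using hω
  · simpa using h1

/-- Multiplication by `u` on the second coordinate of a quadratic algebra. -/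
def smulIm (u : R) : QuadraticAlgebra R a b →ₗ[R] QuadraticAlgebra R a b where
  toFun z := ⟨z.re, u * z.im⟩
  map_add' _ _ := by ext <;> simp [mul_add]
  map_smul' _ _ := by ext <;> simp [mul_left_comm]

theorem detForm_smulIm (u : R) (x y : QuadraticAlgebra R a b) :
    detForm (smulIm u x) (smulIm u y) = u * detForm x y := by
  simp only [smulIm, detForm_apply, LinearMap.coe_mk, AddHom.coe_mk]
  ring

theorem bijective_of_detForm_eq [Finite R]
    {ψ : QuadraticAlgebra R a b →ₗ[R] QuadraticAlgebra R a b} {u : R} (hu : IsUnit u)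
    (hψ : ∀ x y, detForm (ψ x) (ψ y) = u * detForm x y) :
    Function.Bijective ψ := by
  have : Finite (QuadraticAlgebra R a b) := Module.finite_of_finite R
  refine Finite.injective_iff_bijective.mp ((injective_iff_map_eq_zero ψ).mpr fun x hx => ?_)
  refine eq_zero_of_detForm_eq_zero fun y => hu.mul_right_eq_zero.mp ?_
  rw [← hψ, hx, map_zero, LinearMap.zero_apply]

/-- Glues a similitude `v * ·` of multiplier `u` on the factor `e` of `R`, where the algebra is
étale, to the similitude `smulIm u` on the factor `1 - e`. -/
theorem exists_equiv_detForm_eq_of_isIdempotentElem [Finite R] {e u : R} (he : IsIdempotentElem e)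
    (hu : IsUnit u) {v T : QuadraticAlgebra R a b} (hv : e * norm v = e * u) (hT : e ∣ T.im) :
    ∃ ψ : QuadraticAlgebra R a b ≃ₗ[R] QuadraticAlgebra R a b,
      (∀ x y, detForm (ψ x) (ψ y) = u * detForm x y) ∧ ∀ x, ψ (T * x) = T * ψ x := by
  let ψ := e • LinearMap.mulLeft R v + (1 - e) • smulIm u
  have hψ (x y) : detForm (ψ x) (ψ y) = u * detForm x y := by
    have h1 := detForm_mul_mul v x y
    have h2 := detForm_smulIm u x y
    simp only [ψ, LinearMap.add_apply, LinearMap.smul_apply, LinearMap.mulLeft_apply, map_add,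
      map_smul, smul_eq_mul]
    linear_combination e ^ 2 * h1 + (1 - e) ^ 2 * h2 + e * detForm x y * hv +
      (2 * u * detForm x y - detForm (v * x) (smulIm u y) - detForm (smulIm u x) (v * y)) * he.eq
  refine ⟨.ofBijective ψ (bijective_of_detForm_eq hu hψ), hψ, fun x => ?_⟩
  have hT0 : (1 - e) * T.im = 0 := by
    obtain ⟨t, ht⟩ := hT
    rw [ht]
    linear_combination -t * he.eq
  change ψ (T * x) = T * ψ x
  ext <;> simp only [ψ, smulIm, LinearMap.add_apply, LinearMap.smul_apply, LinearMap.mulLeft_apply,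
    LinearMap.coe_mk, AddHom.coe_mk, re_add, im_add, re_smul, im_smul, re_mul, im_mul, smul_eq_mul]
  · linear_combination (a * x.im * (1 - u)) * hT0
  · linear_combination (x.re * (u - 1)) * hT0

theorem exists_equiv_detForm_eq [Finite R] (p : ℕ) [Fact p.Prime] [CharP R p] {M : ℕ} (hM : M ≠ 0)
    (hω : ((ω : QuadraticAlgebra R a b) ^ p ^ M) ^ p ^ M = ω ^ p ^ M) {u : R} (hu : IsUnit u) :
    ∃ ψ : QuadraticAlgebra R a b ≃ₗ[R] QuadraticAlgebra R a b,
      (∀ x y, detForm (ψ x) (ψ y) = u * detForm x y) ∧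
        ∀ x, ψ (ω ^ p ^ M * x) = ω ^ p ^ M * ψ x := by
  obtain ⟨n, hn, he⟩ := exists_isIdempotentElem_pow (b ^ 2 + 4 * a)
  obtain ⟨v, hv⟩ := exists_mul_norm_eq hn he hu
  have stable (j : ℕ) : (ω : QuadraticAlgebra R a b) ^ p ^ (M * (j + 1)) = ω ^ p ^ M := by
    induction j with
    | zero => simp
    | succ j ih => rw [mul_add_one, pow_add, pow_mul, ih, hω]
  -- a high `p`-power of `ω` is a constant on the factor of `R` on which the discriminant vanishes
  refine exists_equiv_detForm_eq_of_isIdempotentElem he hu hv ?_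
  rw [← stable (2 * n)]
  exact disc_pow_dvd_im_omega_pow p (by nlinarith [Nat.pos_of_ne_zero hM])

end DetForm

section MulForm

variable {k R : Type*} [CommRing k] [CommRing R] [Algebra k R]

/-- The form `(x, y) ↦ μ (x * y)`; its nondegeneracy says that `μ` generates the dual of the
Frobenius algebra `R` as an `R`-module. -/
def mulForm (μ : R →ₗ[k] k) : LinearMap.BilinForm k R :=
  (LinearMap.mul k R).compr₂ μ

theorem mulForm_apply (μ : R →ₗ[k] k) (x y : R) : mulForm μ x y = μ (x * y) := rfl

theorem mulForm_isSymm (μ : R →ₗ[k] k) : (mulForm μ).IsSymm :=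
  ⟨fun x y => by simp only [mulForm_apply, mul_comm x y]⟩

theorem mulForm_nondegenerate_iff {μ : R →ₗ[k] k} :
    (mulForm μ).Nondegenerate ↔ ∀ x, (∀ y, μ (x * y) = 0) → x = 0 :=
  (mulForm_isSymm μ).isRefl.nondegenerate_iff_separatingLeft

theorem exists_mulForm_nondegenerate {f : k[X]} (h : IsAdjoinRootMonic R f) :
    ∃ μ : R →ₗ[k] k, (mulForm μ).Nondegenerate := by
  refine ⟨lcoeff k (f.natDegree - 1) ∘ₗ h.modByMonicHom,
    mulForm_nondegenerate_iff.mpr fun x hx => ?_⟩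
  nontriviality R
  have : Nontrivial k := Module.nontrivial k R
  obtain ⟨g, hg, rfl⟩ : ∃ g : k[X], g.degree < f.degree ∧ h.map g = x := by
    obtain ⟨g, rfl⟩ := h.map_surjective x
    exact ⟨g %ₘ f, degree_modByMonic_lt g h.monic, h.map_modByMonic g⟩
  by_contra hne
  have hg0 : g ≠ 0 := fun h0 => hne (by rw [h0, map_zero])
  have hlt : g.natDegree < f.natDegree := natDegree_lt_natDegree hg0 hg
  have hX := hx (h.map (X ^ (f.natDegree - 1 - g.natDegree)))
  have hdeg : (g * X ^ (f.natDegree - 1 - g.natDegree)).degree < f.degree := by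
    rw [degree_mul_X_pow, degree_eq_natDegree hg0, degree_eq_natDegree h.monic.ne_zero]
    exact_mod_cast (by lia)
  rw [← map_mul, LinearMap.comp_apply, h.modByMonicHom_map,
    (modByMonic_eq_self_iff h.monic).mpr hdeg, lcoeff_apply] at hX
  refine hg0 (leadingCoeff_eq_zero.mp ?_)
  rwa [show f.natDegree - 1 = g.natDegree + (f.natDegree - 1 - g.natDegree) by lia,
    Nat.add_sub_cancel_left, coeff_mul_X_pow] at hX

end MulForm

section MulForm

variable {k R : Type*} [Field k] [CommRing R] [Algebra k R] [Module.Finite k R]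

theorem exists_eq_mulForm {μ : R →ₗ[k] k} (hμ : (mulForm μ).Nondegenerate) (μ' : R →ₗ[k] k) :
    ∃ r, mulForm μ r = μ' :=
  ⟨((mulForm μ).toDual hμ).symm μ', ((mulForm μ).toDual hμ).apply_symm_apply μ'⟩

theorem exists_isUnit_eq_mulForm {μ μ' : R →ₗ[k] k} (hμ : (mulForm μ).Nondegenerate)
    (hμ' : (mulForm μ').Nondegenerate) : ∃ u, IsUnit u ∧ mulForm μ u = μ' := by
  obtain ⟨u, hu⟩ := exists_eq_mulForm hμ μ'
  obtain ⟨v, hv⟩ := exists_eq_mulForm hμ' μ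
  refine ⟨u, .of_mul_eq_one v (sub_eq_zero.mp (mulForm_nondegenerate_iff.mp hμ _ fun y => ?_)), hu⟩
  rw [sub_mul, map_sub, one_mul, sub_eq_zero]
  conv_rhs => rw [← hv, mulForm_apply, ← hu, mulForm_apply]
  rw [mul_assoc]

end MulForm

section Form

variable {k R : Type*} [CommRing k] [CommRing R] [Algebra k R] {a b : R}

/-- The alternating form `μ ∘ det` on a quadratic algebra. -/
def form (μ : R →ₗ[k] k) : LinearMap.BilinForm k (QuadraticAlgebra R a b) :=
  (detForm.restrictScalars₁₂ k k).compr₂ μ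

theorem form_apply (μ : R →ₗ[k] k) (x y : QuadraticAlgebra R a b) :
    form μ x y = μ (detForm x y) := rfl

theorem form_mul_left (μ : R →ₗ[k] k) (z x y : QuadraticAlgebra R a b) :
    form μ (z * x) y = form μ x (star z * y) := by
  rw [form_apply, detForm_mul_left, form_apply]

theorem form_isAlt (μ : R →ₗ[k] k) :
    (form μ : LinearMap.BilinForm k (QuadraticAlgebra R a b)).IsAlt :=
  fun x => by rw [form_apply, detForm_apply, sub_self, map_zero]

theorem form_nondegenerate_iff {μ : R →ₗ[k] k} :
    (form μ : LinearMap.BilinForm k (QuadraticAlgebra R a b)).Nondegenerate ↔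
      (mulForm μ).Nondegenerate := by
  refine (form_isAlt μ).isRefl.nondegenerate_iff_separatingLeft.trans
    (Iff.trans ?_ mulForm_nondegenerate_iff.symm)
  refine ⟨fun h r hr => ?_, fun h x hx => eq_zero_of_detForm_eq_zero fun y => h _ fun r => ?_⟩
  · have hr' : algebraMap R (QuadraticAlgebra R a b) r = 0 :=
      h _ fun y => by simpa [form_apply, detForm_apply] using hr y.im
    simpa using congr_arg re hr'
  · rw [mul_comm, ← smul_eq_mul, ← map_smul]
    exact hx (r • y)

end Form

section Adjoint

variable {k R : Type*} [CommRing k] [CommRing R] [Algebra k R] {a b : R}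
  {B : LinearMap.BilinForm k (QuadraticAlgebra R a b)}

theorem apply_smul_left (hadj : ∀ z x y, B (z * x) y = B x (star z * y)) (r : R)
    (x y : QuadraticAlgebra R a b) : B (r • x) y = B x (r • y) := by
  have hstar : star (algebraMap R (QuadraticAlgebra R a b) r) = algebraMap R _ r := by
    ext <;> simp
  rw [Algebra.smul_def, hadj, hstar, ← Algebra.smul_def]

theorem apply_self_smul_eq_zero (hB : B.IsAlt) (hb : Algebra.adjoin k {b} = ⊤)
    (hadj : ∀ z x y, B (z * x) y = B x (star z * y)) (r : R) (x : QuadraticAlgebra R a b) :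
    B x (r • x) = 0 := by
  have hb_self (x) : B x (b • x) = 0 := by
    have htrace : b • x = ω * x + star ω * x := by
      rw [← add_mul, ← algebraMap_trace_eq_add_star, Algebra.smul_def]
      simp [trace_def]
    rw [htrace, map_add, ← hadj, ← hB.neg_eq, neg_add_cancel]
  have hpow (n : ℕ) : B x (b ^ n • x) = 0 := by
    obtain ⟨m, rfl | rfl⟩ := n.even_or_odd'
    · rw [two_mul, pow_add, mul_smul, ← apply_smul_left hadj]
      exact hB _
    · have hodd : b ^ (2 * m + 1) • x = b ^ m • b • b ^ m • x := by
        simp only [smul_smul]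
        ring_nf
      rw [hodd, ← apply_smul_left hadj]
      exact hb_self _
  obtain ⟨P, rfl⟩ : ∃ P : k[X], aeval b P = r := by
    rw [Algebra.adjoin_singleton_eq_range_aeval, AlgHom.range_eq_top] at hb
    exact hb r
  rw [aeval_eq_sum_range, Finset.sum_smul, map_sum]
  exact Finset.sum_eq_zero fun n _ => by rw [smul_assoc, map_smul, hpow, smul_zero]

theorem exists_eq_form (hB : B.IsAlt) (hb : Algebra.adjoin k {b} = ⊤)
    (hadj : ∀ z x y, B (z * x) y = B x (star z * y)) : ∃ μ : R →ₗ[k] k, B = form μ := by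
  let μ : R →ₗ[k] k :=
    B 1 ∘ₗ (LinearMap.toSpanSingleton R (QuadraticAlgebra R a b) ω).restrictScalars k
  have hμ (x y : R) : B (x • 1) (y • ω) = μ (x * y) := by
    rw [apply_smul_left hadj, smul_smul]
    rfl
  have hself (x y : R) (z) : B (x • z) (y • z) = 0 := by
    rw [apply_smul_left hadj, smul_smul, apply_self_smul_eq_zero hB hb hadj]
  have hcoord (x : QuadraticAlgebra R a b) : x = x.re • 1 + x.im • ω := by
    ext <;> simp
  refine ⟨μ, LinearMap.ext₂ fun x y => ?_⟩
  calc B x y = B (x.re • 1) (y.im • ω) - B (y.re • 1) (x.im • ω) := by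
        conv_lhs => rw [hcoord x, hcoord y]
        simp only [map_add, LinearMap.add_apply, hself, ← hB.neg_eq (x.im • ω)]
        ring
    _ = form μ x y := by rw [hμ, hμ, ← map_sub, form_apply, detForm_apply]

end Adjoint

section WeilAlgebra

/-- The algebra generated over `R` by a root `ω` of `T² - s T + q`. It models `ℤ[ϖ]`, with
`s = ϖ + ϖ̄`, and `star` is then complex conjugation. -/
abbrev WeilAlgebra {k R : Type*} [CommRing k] [CommRing R] [Algebra k R] (q : k) (s : R) :=
  QuadraticAlgebra R (-algebraMap k R q) s

variable {k R : Type*} [CommRing k] [CommRing R] [Algebra k R] {q : k} {s : R}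

theorem norm_omega :
    norm (ω : WeilAlgebra q s) = algebraMap k R q := by
  simp [norm_def]

theorem omega_mul_star_omega :
    (ω * star ω : WeilAlgebra q s) = algebraMap k _ q := by
  rw [← algebraMap_norm_eq_mul_star, norm_omega]
  exact (IsScalarTower.algebraMap_apply ..).symm

theorem algebraMap_eq_omega_add_star_omega :
    algebraMap R (WeilAlgebra q s) s = ω + star ω := by
  rw [← algebraMap_trace_eq_add_star]
  simp [trace_def]

theorem isUnit_omega (hq : IsUnit q) :
    IsUnit (ω : WeilAlgebra q s) :=
  isUnit_iff_norm_isUnit.mpr (by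
    rw [norm_omega]
    exact hq.map (algebraMap k R))

theorem adjoin_omega_eq_top [Finite R] (hq : IsUnit q) (hs : Algebra.adjoin k {s} = ⊤) :
    Algebra.adjoin k {(ω : WeilAlgebra q s)} = ⊤ := by
  set S := Algebra.adjoin k {(ω : WeilAlgebra q s)}
  have hω : ω ∈ S := Algebra.self_mem_adjoin_singleton k _
  have hstar : star ω ∈ S := by
    have : Finite (WeilAlgebra q s) := Module.finite_of_finite R
    obtain ⟨n, hn, h1⟩ := (isUnit_omega (s := s) hq).isOfFinOrder.exists_pow_eq_one
    have hinv : star (ω : WeilAlgebra q s) =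
        algebraMap k _ q * ω ^ (n - 1) := by
      rw [← omega_mul_star_omega, mul_comm ω, mul_assoc, mul_pow_sub_one hn.ne', h1, mul_one]
    exact hinv ▸ mul_mem (S.algebraMap_mem q) (pow_mem hω _)
  have hbase (r : R) : algebraMap R _ r ∈ S := by
    suffices h : Algebra.adjoin k {s} ≤ S.comap (IsScalarTower.toAlgHom k R _) from
      h (hs ▸ Algebra.mem_top)
    refine Algebra.adjoin_le (Set.singleton_subset_iff.mpr ?_)
    have htrace : algebraMap R _ s = (ω + star ω : WeilAlgebra q s) :=
      algebraMap_eq_omega_add_star_omega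
    exact (htrace ▸ add_mem hω hstar : algebraMap R _ s ∈ S)
  refine top_le_iff.mp fun z _ => ?_
  have hz : z = algebraMap R _ z.re + algebraMap R _ z.im * ω := by
    ext <;> simp
  exact hz ▸ add_mem (hbase _) (mul_mem (hbase _) hω)

theorem adjoin_eq_top_of_adjoin_omega_star_omega
    (h : Algebra.adjoin k {(ω : WeilAlgebra q s), star ω} = ⊤) : Algebra.adjoin k {s} = ⊤ := by
  set S := Algebra.adjoin k {s}
  have hs : s ∈ S := Algebra.self_mem_adjoin_singleton k s
  have hcoord (z : WeilAlgebra q s) : z.re ∈ S ∧ z.im ∈ S := by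
    have hz : z ∈ Algebra.adjoin k {(ω : WeilAlgebra q s), star ω} := h ▸ Algebra.mem_top
    induction hz using Algebra.adjoin_induction with
    | mem z hz =>
      rcases hz with rfl | rfl
      · simp [zero_mem, one_mem]
      · simp [hs, one_mem]
    | algebraMap c => exact ⟨S.algebraMap_mem c, zero_mem S⟩
    | add y z _ _ hy hz => exact ⟨add_mem hy.1 hz.1, add_mem hy.2 hz.2⟩
    | mul y z _ _ hy hz =>
      rw [re_mul, im_mul]
      have hq : -algebraMap k R q ∈ S := neg_mem (S.algebraMap_mem q)
      exact ⟨add_mem (mul_mem hy.1 hz.1) (mul_mem (mul_mem hq hy.2) hz.2),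
        add_mem (add_mem (mul_mem hy.1 hz.2) (mul_mem hy.2 hz.1))
          (mul_mem (mul_mem hs hy.2) hz.2)⟩
  exact top_le_iff.mp fun r _ => (hcoord (algebraMap R _ r)).1

theorem apply_mul_left_of_apply_omega_mul (hq : IsUnit q)
    {B : LinearMap.BilinForm k (WeilAlgebra q s)}
    (hω : Algebra.adjoin k {(ω : WeilAlgebra q s)} = ⊤)
    (hB : ∀ x y, B (ω * x) (ω * y) = q * B x y)
    (z x y : WeilAlgebra q s) : B (z * x) y = B x (star z * y) := by
  have hz : z ∈ Algebra.adjoin k {(ω : WeilAlgebra q s)} :=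
    hω ▸ Algebra.mem_top
  induction hz using Algebra.adjoin_induction generalizing x y with
  | mem z hz =>
    rw [Set.mem_singleton_iff.mp hz]
    refine hq.mul_left_cancel ?_
    rw [← hB x, ← mul_assoc ω, omega_mul_star_omega, ← Algebra.smul_def, map_smul, smul_eq_mul]
  | algebraMap c =>
    have hstar : star (algebraMap k (WeilAlgebra q s) c) =
        algebraMap k _ c := by
      rw [IsScalarTower.algebraMap_apply k R (WeilAlgebra q s)]
      ext <;> simp
    rw [hstar, ← Algebra.smul_def, ← Algebra.smul_def, map_smul, map_smul, LinearMap.smul_apply]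
  | add z w _ _ hz hw =>
    rw [add_mul, map_add, LinearMap.add_apply, hz, hw, star_add, add_mul, map_add]
  | mul z w _ _ hz hw => rw [mul_assoc, hz, hw, star_mul, mul_assoc]

end WeilAlgebra

theorem exists_weilAlgebra_algEquiv {k R A : Type*} [Field k] [CommRing R] [CommRing A]
    [Algebra k R] [Algebra k A] [Module.Finite k R] [Module.Finite k A] {q : k} {s : R}
    (j : R →ₐ[k] A) {t t' : A} (hj : j s = t + t') (hmul : t * t' = algebraMap k A q)
    (hadj : Algebra.adjoin k {t, t'} = ⊤)
    (hfinrank : Module.finrank k A = 2 * Module.finrank k R) :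
    ∃ e : WeilAlgebra q s ≃ₐ[k] A, e ω = t ∧ e (star ω) = t' := by
  let _ : Algebra R A := j.toAlgebra
  have : IsScalarTower k R A := .of_algHom j
  have ht : t * t = (-algebraMap k R q) • (1 : A) + s • t := by
    rw [neg_smul, algebraMap_smul, ← Algebra.algebraMap_eq_smul_one, ← hmul, Algebra.smul_def,
      show algebraMap R A s = t + t' from hj]
    ring
  let F : WeilAlgebra q s →ₐ[k] A := (lift ⟨t, ht⟩).restrictScalars k
  have hω : F ω = t := (congrArg₂ (· + ·) (zero_smul R 1) (one_smul R t)).trans (zero_add t)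
  have hstar : F (star ω) = t' := by
    have htrace : F (algebraMap R _ s) = t + t' := by
      rw [← hj]
      exact AlgHom.commutes (lift ⟨t, ht⟩) s
    rw [algebraMap_eq_omega_add_star_omega, map_add, hω] at htrace
    exact add_left_cancel htrace
  have hF : Function.Surjective F := by
    rw [← AlgHom.range_eq_top, ← top_le_iff, ← hadj, Algebra.adjoin_le_iff, Set.pair_subset_iff]
    exact ⟨⟨ω, hω⟩, ⟨star ω, hstar⟩⟩
  have : Module.Finite k (WeilAlgebra q s) := .trans R _
  have hdim : Module.finrank k (WeilAlgebra q s) = Module.finrank k A := by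
    rw [((linearEquivTuple _ s).restrictScalars k).finrank_eq, Module.finrank_pi_fintype, hfinrank]
    simp
  exact ⟨.ofBijective F ⟨(LinearMap.injective_iff_surjective_of_finrank_eq_finrank
    (f := F.toLinearMap) hdim).mpr hF, hF⟩, hω, hstar⟩

section SymplecticBasis

variable {k R : Type*} [Field k] [CommRing R] [Algebra k R] {a b : R}

theorem exists_basis_form_eq_J (hR : Module.finrank k R = 2) {μ : R →ₗ[k] k}
    (hμ : (mulForm μ).Nondegenerate) :
    ∃ e : Module.Basis (Fin 2 ⊕ Fin 2) k (QuadraticAlgebra R a b),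
      ∀ i j, form μ (e i) (e j) = J k i j := by
  have : Module.Finite k R := Module.finite_of_finrank_pos (by lia)
  let c := Module.finBasisOfFinrankEq k R hR
  let d := (mulForm μ).dualBasis hμ c
  have hcd (i j) : μ (c i * d j) = if i = j then 1 else 0 :=
    LinearMap.BilinForm.apply_dualBasis_right hμ (mulForm_isSymm μ) c i j
  let prodEquiv : (R × R) ≃ₗ[k] QuadraticAlgebra R a b :=
    { (equivProd a b).symm with
      map_add' := fun _ _ => rfl
      map_smul' := fun _ _ => rfl }
  refine ⟨(c.prod d).map prodEquiv, ?_⟩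
  rintro (i | i) (j | j) <;>
    simp [prodEquiv, form_apply, detForm_apply, J, equivProd, hcd, Matrix.one_apply, eq_comm]

end SymplecticBasis

/-! ### Semisimplification over a finite field -/

theorem exists_pow_idempotent (G : Type*) [Group G] [Finite G] (p : ℕ)
    [hp : Fact p.Prime] : ∃ M, M ≠ 0 ∧ ∃ m, ¬ p ∣ m ∧
      ∀ g : G, (g ^ p ^ M) ^ m = 1 ∧ (g ^ p ^ M) ^ p ^ M = g ^ p ^ M := by
  obtain ⟨a, m, hm, hG⟩ :=
    Nat.exists_eq_pow_mul_and_not_dvd (Nat.card_pos (α := G)).ne' p hp.out.ne_one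
  have hφ : m.totient ≠ 0 := by
    rw [Ne, Nat.totient_eq_zero]
    exact fun h => hm (h ▸ dvd_zero p)
  set M := (a + 1) * m.totient with hM
  have hkill (g : G) : (g ^ p ^ M) ^ m = 1 := by
    have hdvd : Nat.card G ∣ p ^ M * m := by
      rw [hG]
      gcongr
      exact a.le_succ.trans (Nat.le_mul_of_pos_right _ (Nat.pos_of_ne_zero hφ))
    rw [← pow_mul, orderOf_dvd_iff_pow_eq_one.mp ((orderOf_dvd_natCard g).trans hdvd)]
  have hmod : p ^ M ≡ 1 [MOD m] := by
    rw [hM, mul_comm, pow_mul]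
    simpa using (Nat.ModEq.pow_totient ((hp.out.coprime_iff_not_dvd).mpr hm)).pow (a + 1)
  refine ⟨M, mul_ne_zero a.succ_ne_zero hφ, m, hm, fun g => ⟨hkill g, ?_⟩⟩
  simpa using pow_eq_pow_of_modEq hmod (hkill g)

section Semisimplification

variable {k V : Type*} [Field k]

theorem isSemisimple_of_pow_eq_one [AddCommGroup V] [Module k V] {p : ℕ} [CharP k p] {m : ℕ}
    (hm : ¬ p ∣ m) {f : Module.End k V} (hf : f ^ m = 1) : f.IsSemisimple := by
  refine Module.End.isSemisimple_of_squarefree_aeval_eq_zero (p := X ^ m - 1) ?_ (by simp [hf])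
  exact Separable.squarefree <|
    X_pow_sub_one_separable_iff.mpr (by rwa [Ne, CharP.cast_eq_zero_iff k p])

theorem eq_of_isSemisimple_of_isNilpotent_sub [PerfectField k] [AddCommGroup V] [Module k V]
    [FiniteDimensional k V] {f s t : Module.End k V} (hs : s.IsSemisimple) (ht : t.IsSemisimple)
    (hst : Commute s t) (hsf : Commute s f) (htf : Commute t f) (hfs : IsNilpotent (f - s))
    (hft : IsNilpotent (f - t)) : s = t := by
  have hnil : IsNilpotent (s - t) := by
    rw [← sub_sub_sub_cancel_left t s f]
    exact Commute.isNilpotent_sub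
      ((Commute.refl f).sub_right hsf.symm |>.sub_left (htf.sub_right hst.symm)) hft hfs
  exact sub_eq_zero.mp <|
    Module.End.eq_zero_of_isNilpotent_isSemisimple hnil (hs.sub_of_commute hst ht)

theorem exists_isSemisimplification_iff (k : Type*) [Field k] [Finite k] (p : ℕ) [Fact p.Prime]
    [CharP k p] : ∃ M, M ≠ 0 ∧
      (∀ γ : GL (Fin 2 ⊕ Fin 2) k, (γ ^ p ^ M) ^ p ^ M = γ ^ p ^ M) ∧
      ∀ γ s : GL (Fin 2 ⊕ Fin 2) k, IsSemisimplification γ s ↔ s = γ ^ p ^ M := by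
  obtain ⟨M, hM, m, hm, hpow⟩ := exists_pow_idempotent (GL (Fin 2 ⊕ Fin 2) k) p
  have hss (γ : GL (Fin 2 ⊕ Fin 2) k) : IsSemisimplification γ (γ ^ p ^ M) := by
    refine ⟨isSemisimple_of_pow_eq_one hm ?_, Commute.pow_self γ _, p ^ M, ?_⟩
    · rw [← Matrix.toLin'_pow, ← Units.val_pow_eq_pow_val, (hpow γ).1, Units.val_one,
        Matrix.toLin'_one, Module.End.one_eq_id]
    · rw [Units.val_pow_eq_pow_val, sub_pow_char_pow_of_commute p M (Commute.self_pow γ.1 _),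
        ← Units.val_pow_eq_pow_val, ← Units.val_pow_eq_pow_val, (hpow γ).2, sub_self]
  refine ⟨M, hM, fun γ => (hpow γ).2, fun γ s => ⟨fun h => ?_, fun h => h ▸ hss γ⟩⟩
  have hmap {x y : GL (Fin 2 ⊕ Fin 2) k} (hxy : Commute x y) :
      Commute (Matrix.toLinAlgEquiv' x.1) (Matrix.toLinAlgEquiv' y.1) :=
    (hxy.map (Units.coeHom _)).map Matrix.toLinAlgEquiv'
  have hnil {x : GL (Fin 2 ⊕ Fin 2) k} (hx : IsNilpotent (γ.1 - x.1)) :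
      IsNilpotent (Matrix.toLinAlgEquiv' γ.1 - Matrix.toLinAlgEquiv' x.1) := by
    rw [← map_sub]
    exact hx.map Matrix.toLinAlgEquiv'
  exact Units.ext <| Matrix.toLinAlgEquiv'.injective <|
    eq_of_isSemisimple_of_isNilpotent_sub h.1 (hss γ).1 (hmap (h.2.1.pow_right _)) (hmap h.2.1)
      (hmap (hss γ).2.1) (hnil h.2.2) (hnil (hss γ).2.2)

end Semisimplification

/-! ### Cyclic endomorphisms and their conjugates -/

section Cyclic

variable {k A V : Type*} [Field k] [CommRing A] [Algebra k A] [Module.Finite k A]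
  [AddCommGroup V] [Module k V] [FiniteDimensional k V]

theorem charpoly_mulLeft_eq_minpoly {w : A} (hw : Algebra.adjoin k {w} = ⊤) :
    (LinearMap.mulLeft k w).charpoly = minpoly k w := by
  let pb := PowerBasis.ofAdjoinEqTop (Algebra.IsIntegral.isIntegral (R := k) w) hw
  have hgen : pb.gen = w := PowerBasis.ofAdjoinEqTop_gen _ hw
  rw [← LinearMap.charpoly_toMatrix _ pb.basis, ← hgen]
  exact charpoly_leftMulMatrix pb

theorem exists_equiv_of_charpoly_eq {w : A} (hw : Algebra.adjoin k {w} = ⊤) {g : Module.End k V}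
    (hg : g.charpoly = (LinearMap.mulLeft k w).charpoly) {v : V}
    (hv : Submodule.span k (Set.range fun i : ℕ => (g ^ i) v) = ⊤) :
    ∃ φ : A ≃ₗ[k] V, ∀ a, φ (w * a) = g (φ a) := by
  let pb := PowerBasis.ofAdjoinEqTop (Algebra.IsIntegral.isIntegral (R := k) w) hw
  have hgen : pb.gen = w := PowerBasis.ofAdjoinEqTop_gen _ hw
  let F : A →ₐ[k] Module.End k V := pb.lift g <| by
    rw [hgen, ← charpoly_mulLeft_eq_minpoly hw, ← hg, LinearMap.aeval_self_charpoly]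
  have hFw : F w = g := by
    rw [← hgen]
    exact pb.lift_gen _ _
  let φ : A →ₗ[k] V := LinearMap.applyₗ v ∘ₗ F.toLinearMap
  have hsurj : Function.Surjective φ := by
    rw [← LinearMap.range_eq_top, ← top_le_iff, ← hv, Submodule.span_le]
    rintro _ ⟨i, rfl⟩
    exact ⟨w ^ i, by simp [φ, hFw]⟩
  have hdim : Module.finrank k A = Module.finrank k V := by
    rw [← g.charpoly_natDegree, hg, LinearMap.charpoly_natDegree]
  refine ⟨.ofBijective φ ⟨(LinearMap.injective_iff_surjective_of_finrank_eq_finrank hdim).mpr hsurj,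
    hsurj⟩, fun a => ?_⟩
  change F (w * a) v = g (F a v)
  rw [map_mul, hFw, Module.End.mul_apply]

theorem charpoly_pow_card_pow [Finite k] (g : Module.End k V) (j : ℕ) :
    (g ^ Nat.card k ^ j).charpoly = g.charpoly := by
  have := Fintype.ofFinite k
  let b := Module.finBasis k V
  have hstep (h : Module.End k V) : (h ^ Nat.card k).charpoly = h.charpoly := by
    rw [← LinearMap.charpoly_toMatrix _ b, ← LinearMap.charpoly_toMatrix h b,
      ← LinearMap.toMatrix_pow, Nat.card_eq_fintype_card, FiniteField.Matrix.charpoly_pow_card]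
  induction j with
  | zero => rw [pow_zero, pow_one]
  | succ j ih => rw [pow_succ, pow_mul, hstep, ih]

end Cyclic

theorem ncard_eq_ncard_image_conj_mul {G : Type*} [Group G] (w : G) {T : Set G}
    (hT : ∀ φ ∈ T, ∀ c ∈ Subgroup.centralizer {w}, φ * c ∈ T) :
    T.ncard = ((fun φ => φ * w * φ⁻¹) '' T).ncard * Nat.card (Subgroup.centralizer {w}) := by
  choose! σ hσT hσ using fun y (hy : y ∈ (fun φ => φ * w * φ⁻¹) '' T) => hy
  have hconj {φ ψ : G} : φ * w * φ⁻¹ = ψ * w * ψ⁻¹ ↔ φ⁻¹ * ψ ∈ Subgroup.centralizer {w} := by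
    rw [Subgroup.mem_centralizer_singleton_iff, eq_mul_inv_iff_mul_eq, mul_assoc, mul_assoc,
      ← eq_inv_mul_iff_mul_eq, ← mul_assoc φ⁻¹ ψ]
    exact eq_comm
  have hfibre {y c : G} (hy : y ∈ (fun φ => φ * w * φ⁻¹) '' T)
      (hc : c ∈ Subgroup.centralizer {w}) : y = σ y * c * w * (σ y * c)⁻¹ := by
    refine (hσ y hy).symm.trans (hconj.mpr ?_)
    rwa [inv_mul_cancel_left]
  have himage : (fun p : G × G => σ p.1 * p.2) ''
      (((fun φ => φ * w * φ⁻¹) '' T) ×ˢ Subgroup.centralizer {w}) = T := by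
    ext φ
    constructor
    · rintro ⟨⟨y, c⟩, ⟨hy, hc⟩, rfl⟩
      exact hT _ (hσT y hy) c hc
    · intro hφ
      have hy := Set.mem_image_of_mem (fun φ => φ * w * φ⁻¹) hφ
      exact ⟨⟨_, _⟩, ⟨hy, hconj.mp (hσ _ hy)⟩, mul_inv_cancel_left _ _⟩
  have hinj : Set.InjOn (fun p : G × G => σ p.1 * p.2)
      (((fun φ => φ * w * φ⁻¹) '' T) ×ˢ Subgroup.centralizer {w}) := by
    rintro ⟨y, c⟩ ⟨hy, hc⟩ ⟨y', c'⟩ ⟨hy', hc'⟩ (h : σ y * c = σ y' * c')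
    obtain rfl : y = y' := (hfibre hy hc).trans (h ▸ (hfibre hy' hc').symm)
    rw [mul_left_cancel h]
  conv_lhs => rw [← himage, hinj.ncard_image, Set.ncard_prod]
  rfl

section MulLeftEquiv

variable {k A : Type*} [CommSemiring k] [CommSemiring A] [Algebra k A]

variable (k) in
/-- The regular representation of the units of a `k`-algebra. -/
def mulLeftEquiv : Aˣ →* (A ≃ₗ[k] A) := DistribMulAction.toModuleAut k A

theorem mulLeftEquiv_apply (u : Aˣ) (a : A) : mulLeftEquiv k u a = u * a := rfl

theorem mulLeftEquiv_injective : Function.Injective (mulLeftEquiv k : Aˣ →* (A ≃ₗ[k] A)) :=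
  fun u v h => Units.ext (by simpa [mulLeftEquiv_apply] using congr($h 1))

theorem centralizer_mulLeftEquiv {w : Aˣ} (hw : Algebra.adjoin k {(w : A)} = ⊤) :
    Subgroup.centralizer {mulLeftEquiv k w} = (mulLeftEquiv k : Aˣ →* (A ≃ₗ[k] A)).range := by
  ext φ
  rw [Subgroup.mem_centralizer_singleton_iff]
  constructor
  · intro hφ
    have hmul (a b : A) : φ (a * b) = a * φ b := by
      have ha : a ∈ Algebra.adjoin k {(w : A)} := hw ▸ Algebra.mem_top
      induction ha using Algebra.adjoin_induction generalizing b with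
      | mem a ha =>
        rw [Set.mem_singleton_iff.mp ha]
        exact congr($hφ b)
      | algebraMap c => rw [← Algebra.smul_def, map_smul, Algebra.smul_def]
      | add a a' _ _ ha ha' => rw [add_mul, map_add, ha, ha', add_mul]
      | mul a a' _ _ ha ha' => rw [mul_assoc, ha, ha', mul_assoc]
    have hunit : IsUnit (φ 1) := .of_mul_eq_one (φ.symm 1) <| by
      rw [mul_comm, ← hmul, mul_one, φ.apply_symm_apply]
    refine ⟨hunit.unit, LinearEquiv.ext fun a => ?_⟩
    rw [mulLeftEquiv_apply, hunit.unit_spec, mul_comm, ← hmul, mul_one]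
  · rintro ⟨u, rfl⟩
    rw [← map_mul, mul_comm, map_mul]

end MulLeftEquiv

/-! ### Counting similitudes -/

section Similitudes

variable {k V : Type*} [Field k] [AddCommGroup V] [Module k V] {B : LinearMap.BilinForm k V}

/-- The similitudes of multiplier `m` of a bilinear form. -/
def similitudes (B : LinearMap.BilinForm k V) (m : k) : Set (V ≃ₗ[k] V) :=
  {g | ∀ x y, B (g x) (g y) = m * B x y}

theorem mul_mem_similitudes {m n : k} {g h : V ≃ₗ[k] V} (hg : g ∈ similitudes B m)
    (hh : h ∈ similitudes B n) : g * h ∈ similitudes B (m * n) := fun x y => by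
  rw [LinearEquiv.mul_apply, LinearEquiv.mul_apply, hg, hh, mul_assoc]

theorem inv_mem_similitudes {m : kˣ} {g : V ≃ₗ[k] V} (hg : g ∈ similitudes B (m : k)) :
    g⁻¹ ∈ similitudes B (↑m⁻¹ : k) := fun x y => by
  rw [Units.eq_inv_mul_iff_mul_eq, ← hg, ← LinearEquiv.mul_apply, ← LinearEquiv.mul_apply,
    mul_inv_cancel]
  rfl

theorem pow_mem_similitudes {m : k} {g : V ≃ₗ[k] V} (hg : g ∈ similitudes B m) (n : ℕ) :
    g ^ n ∈ similitudes B (m ^ n) := by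
  induction n with
  | zero => exact fun x y => by rw [pow_zero, pow_zero, one_mul]; rfl
  | succ n ih => rw [pow_succ, pow_succ]; exact mul_mem_similitudes ih hg

theorem conj_mem_similitudes {m : k} {n : kˣ} {g h : V ≃ₗ[k] V} (hg : g ∈ similitudes B m)
    (hh : h ∈ similitudes B (n : k)) : h * g * h⁻¹ ∈ similitudes B m := by
  have := mul_mem_similitudes (mul_mem_similitudes hh hg) (inv_mem_similitudes hh)
  rwa [mul_right_comm, n.mul_inv, one_mul] at this

theorem eq_of_mem_similitudes (hB : B ≠ 0) {m n : k} {g : V ≃ₗ[k] V} (hm : g ∈ similitudes B m)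
    (hn : g ∈ similitudes B n) : m = n := by
  by_contra hmn
  refine hB (LinearMap.ext₂ fun x y => (mul_eq_zero.mp ?_).resolve_left (sub_ne_zero.mpr hmn))
  rw [sub_mul, ← hm, ← hn, sub_self]

theorem ncard_similitudes {m : kˣ} {g : V ≃ₗ[k] V} (hg : g ∈ similitudes B (m : k)) :
    (similitudes B (m : k)).ncard = (similitudes B 1).ncard := by
  have himage : (g * ·) '' similitudes B 1 = similitudes B (m : k) := by
    ext h
    constructor
    · rintro ⟨h, hh, rfl⟩
      exact mul_one (m : k) ▸ mul_mem_similitudes hg hh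
    · intro hh
      refine ⟨g⁻¹ * h, ?_, mul_inv_cancel_left g h⟩
      exact m.inv_mul ▸ mul_mem_similitudes (inv_mem_similitudes hg) hh
  rw [← himage, Set.ncard_image_of_injective _ (mul_right_injective g)]

end Similitudes

section Transporters

variable {k R : Type*} [Field k] [CommRing R] [Algebra k R] {q : k} {s : R} {μ : R →ₗ[k] k}
  {w : (WeilAlgebra q s)ˣ}

/-- The linear automorphisms `φ` such that `x ↦ φ (ω * φ⁻¹ x)` is a similitude of multiplier `q` of
`form μ`. -/
def transporters (q : k) (s : R) (μ : R →ₗ[k] k) : Set (WeilAlgebra q s ≃ₗ[k] WeilAlgebra q s) :=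
  {φ | ∀ x y, form μ (φ (ω * x)) (φ (ω * y)) = q * form μ (φ x) (φ y)}

theorem mem_transporters_iff (hw : (w : WeilAlgebra q s) = ω)
    {φ : WeilAlgebra q s ≃ₗ[k] WeilAlgebra q s} :
    φ ∈ transporters q s μ ↔ φ * mulLeftEquiv k w * φ⁻¹ ∈ similitudes (form μ) q := by
  have hconj (z : WeilAlgebra q s) : (φ * mulLeftEquiv k w * φ⁻¹) (φ z) = φ (ω * z) := by
    rw [← hw, ← mulLeftEquiv_apply (k := k), ← LinearEquiv.mul_apply, ← LinearEquiv.mul_apply,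
      inv_mul_cancel_right]
  refine φ.toEquiv.forall_congr fun x => φ.toEquiv.forall_congr fun y => ?_
  simp only [LinearEquiv.coe_toEquiv, hconj]

theorem mulLeftEquiv_mem_similitudes (hw : (w : WeilAlgebra q s) = ω) :
    mulLeftEquiv k w ∈ similitudes (form μ) q := fun x y => by
  rw [mulLeftEquiv_apply, mulLeftEquiv_apply, hw, form_mul_left, ← mul_assoc, mul_comm (star ω),
    omega_mul_star_omega, ← Algebra.smul_def, map_smul, smul_eq_mul]

theorem transporters_mul_mem {φ : WeilAlgebra q s ≃ₗ[k] WeilAlgebra q s}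
    (hφ : φ ∈ transporters q s μ) (v : (WeilAlgebra q s)ˣ) :
    φ * mulLeftEquiv k v ∈ transporters q s μ := fun x y => by
  simp only [LinearEquiv.mul_apply, mulLeftEquiv_apply, mul_left_comm _ ω]
  exact hφ _ _

variable (k) in
/-- The dilation `1 ↦ 1`, `ω ↦ u * ω`, which scales the `R`-valued determinant by `u`. -/
def dilation {a b : R} (u : Rˣ) : QuadraticAlgebra R a b ≃ₗ[k] QuadraticAlgebra R a b :=
  (LinearEquiv.ofLinearMap (smulIm (u : R)) (smulIm (↑u⁻¹ : R))
    (by ext <;> simp [smulIm]) (by ext <;> simp [smulIm])).restrictScalars k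

theorem form_dilation {a b : R} (u : Rˣ) (x y : QuadraticAlgebra R a b) :
    form μ (dilation k u x) (dilation k u y) = μ (u * detForm x y) :=
  congr_arg μ (detForm_smulIm (u : R) x y)

theorem exists_form_apply_eq_form_dilation [Module.Finite k R] (hμ : (mulForm μ).Nondegenerate)
    (hq : q ≠ 0) (hs : Algebra.adjoin k {s} = ⊤)
    (hω : Algebra.adjoin k {(ω : WeilAlgebra q s)} = ⊤)
    {φ : WeilAlgebra q s ≃ₗ[k] WeilAlgebra q s} (hφ : φ ∈ transporters q s μ) :
    ∃ u : Rˣ, ∀ x y, form μ (φ x) (φ y) = form μ (dilation k u x) (dilation k u y) := by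
  let B : LinearMap.BilinForm k (WeilAlgebra q s) := (form μ).compl₁₂ φ.toLinearMap φ.toLinearMap
  have hB_alt : B.IsAlt := fun x => form_isAlt μ (φ x)
  have hB_adj := apply_mul_left_of_apply_omega_mul (B := B) hq.isUnit hω hφ
  obtain ⟨μ', hμ'⟩ := exists_eq_form hB_alt hs hB_adj
  have hB_nondeg : B.Nondegenerate :=
    LinearMap.BilinForm.Nondegenerate.congr φ.symm (form_nondegenerate_iff.mpr hμ)
  obtain ⟨u, hu, rfl⟩ :=
    exists_isUnit_eq_mulForm hμ (form_nondegenerate_iff.mp (hμ' ▸ hB_nondeg))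
  exact ⟨hu.unit, fun x y => (congr($hμ' x y)).trans (form_dilation hu.unit x y).symm⟩

theorem image_mul_dilation_eq_transporters [Module.Finite k R] (hμ : (mulForm μ).Nondegenerate)
    (hq : q ≠ 0) (hs : Algebra.adjoin k {s} = ⊤)
    (hω : Algebra.adjoin k {(ω : WeilAlgebra q s)} = ⊤) :
    (fun p : (WeilAlgebra q s ≃ₗ[k] WeilAlgebra q s) × Rˣ => p.1 * dilation k p.2) ''
      (similitudes (form μ) 1 ×ˢ Set.univ) = transporters q s μ := by
  ext φ
  constructor
  · rintro ⟨⟨g, u⟩, ⟨hg, -⟩, rfl⟩ x y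
    have hω_smul : detForm (ω * x) (ω * y) = q • detForm x y := by
      rw [detForm_mul_mul, norm_omega, Algebra.smul_def]
    simp only [LinearEquiv.mul_apply, hg _ _, form_dilation, hω_smul, mul_smul_comm, map_smul,
      smul_eq_mul, one_mul]
  · intro hφ
    obtain ⟨u, hu⟩ := exists_form_apply_eq_form_dilation hμ hq hs hω hφ
    refine ⟨⟨φ * (dilation k u)⁻¹, u⟩, ⟨fun x y => ?_, trivial⟩, inv_mul_cancel_right _ _⟩
    rw [LinearEquiv.mul_apply, LinearEquiv.mul_apply, hu, one_mul, ← LinearEquiv.mul_apply,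
      ← LinearEquiv.mul_apply, mul_inv_cancel]
    rfl

theorem ncard_transporters [Module.Finite k R] (hμ : (mulForm μ).Nondegenerate)
    (hq : q ≠ 0) (hs : Algebra.adjoin k {s} = ⊤)
    (hω : Algebra.adjoin k {(ω : WeilAlgebra q s)} = ⊤) :
    (transporters q s μ).ncard =
      (similitudes (form μ : LinearMap.BilinForm k (WeilAlgebra q s)) 1).ncard * Nat.card Rˣ := by
  have hinj : Set.InjOn
      (fun p : (WeilAlgebra q s ≃ₗ[k] WeilAlgebra q s) × Rˣ => p.1 * dilation k p.2)
      (similitudes (form μ) 1 ×ˢ Set.univ) := by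
    rintro ⟨g, u⟩ ⟨hg, -⟩ ⟨g', u'⟩ ⟨hg', -⟩ (h : g * dilation k u = g' * dilation k u')
    have hμu (x y : WeilAlgebra q s) : μ (u * detForm x y) = μ (u' * detForm x y) := by
      have := congr(form μ ($h x) ($h y))
      simpa only [LinearEquiv.mul_apply, hg _ _, hg' _ _, form_dilation, one_mul] using this
    obtain rfl : u = u' := Units.ext <| sub_eq_zero.mp <|
      mulForm_nondegenerate_iff.mp hμ _ fun y => by
        simpa [detForm_apply, sub_mul, sub_eq_zero] using hμu 1 ⟨0, y⟩
    rw [mul_right_cancel h]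
  rw [← image_mul_dilation_eq_transporters hμ hq hs hω, hinj.ncard_image, Set.ncard_prod,
    Set.ncard_univ]

end Transporters

/-- The cyclic similitudes of `B` whose `N`-th power is conjugate to that of `w` by a similitude;
for a suitable `N` this power is the semisimple part. -/
def cyclicClass {k V : Type*} [Field k] [AddCommGroup V] [Module k V]
    (B : LinearMap.BilinForm k V) (w : V ≃ₗ[k] V) (N : ℕ) : Set (V ≃ₗ[k] V) :=
  {g | (∃ m : kˣ, g ∈ similitudes B (m : k)) ∧
    (∃ v, Submodule.span k (Set.range fun i : ℕ => (g ^ i) v) = ⊤) ∧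
    ∃ h, (∃ m : kˣ, h ∈ similitudes B (m : k)) ∧ h * g ^ N * h⁻¹ = w ^ N}

theorem span_range_pow_conj_mulLeftEquiv {k A V : Type*} [Field k] [CommRing A] [Algebra k A]
    [AddCommGroup V] [Module k V] {w : Aˣ} (hw : Algebra.adjoin k {(w : A)} = ⊤) {g : V ≃ₗ[k] V}
    (φ : A ≃ₗ[k] V) (hφ : ∀ a, φ (w * a) = g (φ a)) :
    Submodule.span k (Set.range fun i : ℕ => (g ^ i) (φ 1)) = ⊤ := by
  have hpow (i : ℕ) : (g ^ i) (φ 1) = φ (w ^ i) := by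
    induction i with
    | zero => rw [pow_zero, pow_zero]; rfl
    | succ i ih => rw [pow_succ', pow_succ', LinearEquiv.mul_apply, ih, hφ]
  have hspan : Submodule.span k (Set.range fun i : ℕ => (w : A) ^ i) = ⊤ := by
    rw [← Submonoid.coe_powers, Submonoid.powers_eq_closure, ← Algebra.adjoin_eq_span, hw,
      Algebra.top_toSubmodule]
  simp only [hpow]
  rw [Set.range_comp' φ, ← LinearEquiv.coe_coe, ← Submodule.map_span, hspan, Submodule.map_top,
    LinearEquiv.range]

section Count

variable {k R : Type*} [Field k] [CommRing R] [Algebra k R] [Nontrivial R]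
  {q : k} {s : R} {μ : R →ₗ[k] k} {w : (WeilAlgebra q s)ˣ}

theorem conj_mulLeftEquiv_mem_cyclicClass [Finite R] (hμ : (mulForm μ).Nondegenerate)
    (hq : q ≠ 0) (hs : Algebra.adjoin k {s} = ⊤) (hw : (w : WeilAlgebra q s) = ω) (p : ℕ)
    [Fact p.Prime] [CharP k p] {M : ℕ} (hM : M ≠ 0) (hwM : (w ^ p ^ M) ^ p ^ M = w ^ p ^ M)
    {φ : WeilAlgebra q s ≃ₗ[k] WeilAlgebra q s} (hφ : φ ∈ transporters q s μ) :
    φ * mulLeftEquiv k w * φ⁻¹ ∈ cyclicClass (form μ) (mulLeftEquiv k w) (p ^ M) := by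
  have : CharP R p := charP_of_injective_algebraMap (algebraMap k R).injective p
  have hω : Algebra.adjoin k {(ω : WeilAlgebra q s)} = ⊤ := adjoin_omega_eq_top hq.isUnit hs
  obtain ⟨u, hu⟩ := exists_form_apply_eq_form_dilation hμ hq hs hω hφ
  have hωM : ((ω : WeilAlgebra q s) ^ p ^ M) ^ p ^ M = ω ^ p ^ M := by
    rw [← hw]; exact_mod_cast hwM
  obtain ⟨ψ, hψu, hψω⟩ := exists_equiv_detForm_eq p hM hωM u.isUnit
  have hψφ (x) : (ψ.restrictScalars k * φ⁻¹) (φ x) = ψ x := congr_arg ψ (φ.symm_apply_apply x)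
  refine ⟨⟨Units.mk0 q hq, (mem_transporters_iff hw).mp hφ⟩,
    ⟨φ 1, span_range_pow_conj_mulLeftEquiv (hw ▸ hω) φ fun a => ?_⟩,
    ψ.restrictScalars k * φ⁻¹, ⟨1, fun x y => ?_⟩, ?_⟩
  · rw [← mulLeftEquiv_apply (k := k), ← LinearEquiv.mul_apply, ← LinearEquiv.mul_apply,
      inv_mul_cancel_right]
  · obtain ⟨x, rfl⟩ := φ.surjective x
    obtain ⟨y, rfl⟩ := φ.surjective y
    rw [hψφ, hψφ, hu, form_dilation, ← hψu, Units.val_one, one_mul]; rfl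
  · have hcomm : ψ.restrictScalars k * mulLeftEquiv k w ^ p ^ M =
        mulLeftEquiv k w ^ p ^ M * ψ.restrictScalars k := LinearEquiv.ext fun x => by
      simp only [← map_pow, LinearEquiv.mul_apply, mulLeftEquiv_apply, Units.val_pow_eq_pow_val, hw]
      exact hψω x
    refine Eq.trans ?_ (mul_inv_eq_iff_eq_mul.mpr hcomm)
    rw [conj_pow]
    group

theorem exists_mem_transporters_of_mem_cyclicClass [Finite k] [Module.Finite k R]
    (hμ : (mulForm μ).Nondegenerate)
    (hω : Algebra.adjoin k {(ω : WeilAlgebra q s)} = ⊤) (hw : (w : WeilAlgebra q s) = ω) {j : ℕ}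
    {g : WeilAlgebra q s ≃ₗ[k] WeilAlgebra q s}
    (hg : g ∈ cyclicClass (form μ) (mulLeftEquiv k w) (Nat.card k ^ j)) :
    ∃ φ ∈ transporters q s μ, φ * mulLeftEquiv k w * φ⁻¹ = g := by
  obtain ⟨⟨m, hm⟩, ⟨v, hv⟩, h, ⟨n, hn⟩, hconj⟩ := hg
  have : Module.Finite k (WeilAlgebra q s) := .trans R _
  have hW := mulLeftEquiv_mem_similitudes (μ := μ) hw
  have hmq : m = q := by
    have hpow := hconj ▸ conj_mem_similitudes (pow_mem_similitudes hm (Nat.card k ^ j)) hn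
    have := Fintype.ofFinite k
    have := eq_of_mem_similitudes (form_nondegenerate_iff.mpr hμ).ne_zero hpow
      (pow_mem_similitudes hW (Nat.card k ^ j))
    simpa only [Nat.card_eq_fintype_card, FiniteField.pow_card_pow] using this
  have hcharpoly : g.toLinearMap.charpoly = (mulLeftEquiv k w).toLinearMap.charpoly := by
    have hend := congr_arg LinearEquiv.automorphismGroup.toLinearMapMonoidHom hconj
    rw [map_mul, map_mul, map_pow, map_pow] at hend
    rw [← charpoly_pow_card_pow g.toLinearMap j, ← h.charpoly_conj,
      ← charpoly_pow_card_pow (mulLeftEquiv k w).toLinearMap j]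
    exact congr_arg LinearMap.charpoly hend
  obtain ⟨φ, hφ⟩ := exists_equiv_of_charpoly_eq (hw ▸ hω) hcharpoly (v := v) <| by
    simpa only [LinearEquiv.pow_apply, Module.End.pow_apply, LinearEquiv.coe_coe] using hv
  obtain rfl : φ * mulLeftEquiv k w * φ⁻¹ = g := by
    rw [mul_inv_eq_iff_eq_mul]
    exact LinearEquiv.ext hφ
  exact ⟨φ, (mem_transporters_iff hw).mpr (hmq ▸ hm), rfl⟩

theorem ncard_cyclicClass_mul_natCard_units [Finite k] [Module.Finite k R]
    (hμ : (mulForm μ).Nondegenerate)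
    (hq : q ≠ 0) (hs : Algebra.adjoin k {s} = ⊤) (hw : (w : WeilAlgebra q s) = ω) (p : ℕ)
    [Fact p.Prime] [CharP k p] {M j : ℕ} (hM : M ≠ 0) (hj : p ^ M = Nat.card k ^ j)
    (hwM : (w ^ p ^ M) ^ p ^ M = w ^ p ^ M) :
    (cyclicClass (form μ) (mulLeftEquiv k w) (p ^ M)).ncard * Nat.card (WeilAlgebra q s)ˣ =
      (similitudes (form μ : LinearMap.BilinForm k (WeilAlgebra q s)) q).ncard * Nat.card Rˣ := by
  have : Finite R := Module.finite_of_finite k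
  have hω : Algebra.adjoin k {(ω : WeilAlgebra q s)} = ⊤ := adjoin_omega_eq_top hq.isUnit hs
  have himage : (fun φ => φ * mulLeftEquiv k w * φ⁻¹) '' transporters q s μ =
      cyclicClass (form μ) (mulLeftEquiv k w) (p ^ M) := by
    ext g
    exact ⟨fun ⟨φ, hφ, hg⟩ => hg ▸ conj_mulLeftEquiv_mem_cyclicClass hμ hq hs hw p hM hwM hφ,
      fun hg => exists_mem_transporters_of_mem_cyclicClass hμ hω hw (hj ▸ hg)⟩
  have hcentralizer := centralizer_mulLeftEquiv (k := k) (hw ▸ hω)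
  have hsim : (similitudes (form μ : LinearMap.BilinForm k (WeilAlgebra q s)) q).ncard =
      (similitudes (form μ) 1).ncard :=
    ncard_similitudes (m := Units.mk0 q hq) (mulLeftEquiv_mem_similitudes hw)
  rw [← himage, Nat.card_congr (MonoidHom.ofInjective (mulLeftEquiv_injective (k := k))).toEquiv,
    ← hcentralizer, ← ncard_eq_ncard_image_conj_mul, ncard_transporters hμ hq hs hω,
    hsim]
  rintro φ hφ c hc
  obtain ⟨v, rfl⟩ := hcentralizer ▸ hc
  exact transporters_mul_mem hφ v

end Count

section Matrices

variable {k V : Type*} [Field k] [AddCommGroup V] [Module k V]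
  {B : LinearMap.BilinForm k V} (b : Module.Basis (Fin 2 ⊕ Fin 2) k V)

/-- The identification of `GL₄(k)` with the linear automorphisms of `V` given by a basis. -/
def glEquiv : GL (Fin 2 ⊕ Fin 2) k ≃* (V ≃ₗ[k] V) :=
  (Matrix.GeneralLinearGroup.toLin' b).trans (LinearMap.GeneralLinearGroup.generalLinearEquiv k V)

theorem equivFun_glEquiv_apply (γ : GL (Fin 2 ⊕ Fin 2) k) (v : V) :
    b.equivFun (glEquiv b γ v) = γ.1.mulVec (b.equivFun v) :=
  b.equivFun.apply_symm_apply _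

theorem toMatrix_glEquiv (γ : GL (Fin 2 ⊕ Fin 2) k) :
    LinearMap.toMatrix b b (glEquiv b γ).toLinearMap = γ.1 := by
  rw [← LinearEquiv.eq_symm_apply, LinearMap.toMatrix_symm]
  refine LinearMap.ext fun v => b.equivFun.injective ?_
  rw [LinearEquiv.coe_coe, equivFun_glEquiv_apply]
  ext i
  rw [Module.Basis.equivFun_apply, Module.Basis.equivFun_apply, Matrix.repr_toLin]

variable {b}

theorem mem_GSpMult_iff (hb : ∀ i j, B (b i) (b j) = J k i j) {m : k}
    {γ : GL (Fin 2 ⊕ Fin 2) k} : γ ∈ GSpMult k m ↔ glEquiv b γ ∈ similitudes B m := by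
  have hJ : LinearMap.BilinForm.toMatrix b B = J k := by
    ext i j
    rw [LinearMap.BilinForm.toMatrix_apply, hb]
  have hsim : glEquiv b γ ∈ similitudes B m ↔
      B.comp (glEquiv b γ).toLinearMap (glEquiv b γ).toLinearMap = m • B :=
    ⟨fun h => LinearMap.ext₂ h, fun h x y => congr($h x y)⟩
  rw [hsim, ← (LinearMap.BilinForm.toMatrix b).injective.eq_iff,
    LinearMap.BilinForm.toMatrix_comp b b,
    map_smul, hJ, toMatrix_glEquiv]
  rfl

theorem mem_GSp_iff (hb : ∀ i j, B (b i) (b j) = J k i j) {γ : GL (Fin 2 ⊕ Fin 2) k} :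
    γ ∈ GSp k ↔ ∃ m : kˣ, glEquiv b γ ∈ similitudes B (m : k) :=
  exists_congr fun _ => mem_GSpMult_iff hb

theorem isCyclicElt_iff {γ : GL (Fin 2 ⊕ Fin 2) k} :
    IsCyclicElt γ ↔
      ∃ v, Submodule.span k (Set.range fun i : ℕ => (glEquiv b γ ^ i) v) = ⊤ := by
  have hpow (v : V) (i : ℕ) :
      b.equivFun ((glEquiv b γ ^ i) v) = (γ.1 ^ i).mulVec (b.equivFun v) := by
    rw [← map_pow, equivFun_glEquiv_apply, Units.val_pow_eq_pow_val]
  refine (b.equivFun.toEquiv.exists_congr fun v => ?_).symm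
  rw [← Submodule.map_eq_top_iff (e := b.equivFun), Submodule.map_span, ← Set.range_comp]
  simp only [Function.comp_def, LinearEquiv.coe_coe, hpow]
  rfl

theorem ncard_GSpMult (hb : ∀ i j, B (b i) (b j) = J k i j) (m : k) :
    (GSpMult k m).ncard = (similitudes B m).ncard := by
  have himage : glEquiv b ⁻¹' similitudes B m = GSpMult k m :=
    Set.ext fun _ => (mem_GSpMult_iff hb).symm
  rw [← himage, Set.ncard_preimage_of_injective_subset_range (glEquiv b).injective
    ((glEquiv b).surjective.range_eq ▸ Set.subset_univ _)]

theorem ncard_sameSemisimplification (hb : ∀ i j, B (b i) (b j) = J k i j) {N : ℕ}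
    (hN : ∀ γ s : GL (Fin 2 ⊕ Fin 2) k, IsSemisimplification γ s ↔ s = γ ^ N)
    (δ : GL (Fin 2 ⊕ Fin 2) k) :
    {γ | γ ∈ GSp k ∧ IsCyclicElt γ ∧ SameSemisimplification γ δ}.ncard =
      (cyclicClass B (glEquiv b δ) N).ncard := by
  have himage : glEquiv b ⁻¹' cyclicClass B (glEquiv b δ) N =
      {γ | γ ∈ GSp k ∧ IsCyclicElt γ ∧ SameSemisimplification γ δ} := by
    ext γ
    refine and_congr (mem_GSp_iff hb).symm (and_congr isCyclicElt_iff.symm ?_)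
    simp only [SameSemisimplification, hN, exists_and_left, exists_eq_left]
    refine ((glEquiv b).toEquiv.exists_congr fun h => and_congr (mem_GSp_iff hb) ?_).symm
    rw [← (glEquiv b).injective.eq_iff]
    simp only [map_mul, map_pow, map_inv]
    rfl
  rw [← himage, Set.ncard_preimage_of_injective_subset_range (glEquiv b).injective
    ((glEquiv b).surjective.range_eq ▸ Set.subset_univ _)]

end Matrices

theorem nuF_eq_of_glEquiv_eq {ℓ : ℕ} [Fact ℓ.Prime] {R : Type*} [CommRing R] [Algebra (ZMod ℓ) R]
    (hR : Module.finrank (ZMod ℓ) R = 2)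
    {q : ℕ} (hq : (q : ZMod ℓ) ≠ 0) {s : R} (hs : Algebra.adjoin (ZMod ℓ) {s} = ⊤)
    {μ : R →ₗ[ZMod ℓ] ZMod ℓ} (hμ : (mulForm μ).Nondegenerate)
    {b : Module.Basis (Fin 2 ⊕ Fin 2) (ZMod ℓ) (WeilAlgebra (q : ZMod ℓ) s)}
    (hb : ∀ i j, form μ (b i) (b j) = J (ZMod ℓ) i j) {w : (WeilAlgebra (q : ZMod ℓ) s)ˣ}
    (hw : (w : WeilAlgebra (q : ZMod ℓ) s) = ω)
    {γ : GL (Fin 2 ⊕ Fin 2) (ZMod ℓ)} (hγ : glEquiv b γ = mulLeftEquiv (ZMod ℓ) w) :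
    nuF ℓ q γ = ℓ ^ 2 * Nat.card Rˣ / Nat.card (WeilAlgebra (q : ZMod ℓ) s)ˣ := by
  obtain ⟨M, hM, hpow, hss⟩ := exists_isSemisimplification_iff (ZMod ℓ) ℓ
  have : Module.Finite (ZMod ℓ) R := Module.finite_of_finrank_eq_succ hR
  have : Nontrivial R := Module.nontrivial_of_finrank_eq_succ (R := ZMod ℓ) hR
  have hwM : (w ^ ℓ ^ M) ^ ℓ ^ M = w ^ ℓ ^ M := mulLeftEquiv_injective (k := ZMod ℓ) <| by
    rw [map_pow, map_pow, ← hγ, ← map_pow, ← map_pow, hpow]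
  have hcount := ncard_cyclicClass_mul_natCard_units hμ hq hs hw ℓ hM (j := M)
    (by rw [Nat.card_zmod]) hwM
  rw [← hγ, ← ncard_sameSemisimplification hb hss, ← ncard_GSpMult hb] at hcount
  have hGSp : (GSpMult (ZMod ℓ) (q : ZMod ℓ)).ncard ≠ 0 := by
    refine ((Set.ncard_pos (Set.toFinite _)).mpr ⟨γ, ?_⟩).ne'
    rw [mem_GSpMult_iff hb, hγ]
    exact mulLeftEquiv_mem_similitudes hw
  have : Finite R := Module.finite_of_finite (ZMod ℓ)
  have : Finite (WeilAlgebra (q : ZMod ℓ) s) := Module.finite_of_finite R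
  rw [nuF, div_div_eq_mul_div, div_eq_div_iff (mod_cast hGSp) (mod_cast Nat.card_pos.ne'),
    mul_right_comm]
  norm_cast
  rw [hcount]
  ring

/-! ### Inertia and Frobenius elements in towers -/

section Galois

theorem natCard_int_quotient_under {S : Type*} [CommRing S] (P : Ideal S) (ℓ : ℕ)
    [P.LiesOver (Ideal.span {(ℓ : ℤ)})] : Nat.card (ℤ ⧸ P.under ℤ) = ℓ := by
  rw [← Ideal.over_def P (Ideal.span {(ℓ : ℤ)}), Int.card_ideal_quot]

theorem natCard_quotient_of_liesOver {E : Type*} [Field E] [NumberField E] (P : Ideal (𝓞 E))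
    [P.IsPrime] (ℓ : ℕ) [P.LiesOver (Ideal.span {(ℓ : ℤ)})] :
    Nat.card (𝓞 E ⧸ P) = ℓ ^ P.inertiaDeg ℤ := by
  rw [Ideal.pow_inertiaDeg ℓ P, Ideal.absNorm_apply, Submodule.cardQuot_apply]

theorem mk_pow_smul_of_isArithFrobAt {E : Type*} [Field E] [CharZero E] {ℓ : ℕ}
    {P : Ideal (𝓞 E)} [P.LiesOver (Ideal.span {(ℓ : ℤ)})] {F : E ≃ₐ[ℚ] E}
    (hF : IsArithFrobAt ℤ F P) (n : ℕ) (x : 𝓞 E) :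
    Ideal.Quotient.mk P ((F ^ n) • x) = Ideal.Quotient.mk P x ^ ℓ ^ n := by
  induction n with
  | zero => simp
  | succ n ih =>
    have hfrob : Ideal.Quotient.mk P (F • (F ^ n) • x) = Ideal.Quotient.mk P ((F ^ n) • x) ^ ℓ := by
      rw [← natCard_int_quotient_under P ℓ]
      exact hF.mk_apply _
    rw [pow_succ', mul_smul, hfrob, ih, pow_succ, pow_mul]

variable {ℓ : ℕ} [hℓ : Fact ℓ.Prime]

theorem span_natCast_ne_bot : Ideal.span {(ℓ : ℤ)} ≠ ⊥ := by simpa using hℓ.out.ne_zero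

theorem liesOver_span_natCast_iff {S : Type*} [CommRing S] (P : Ideal S) [P.IsPrime] :
    P.LiesOver (Ideal.span {(ℓ : ℤ)}) ↔ (ℓ : S) ∈ P := by
  rw [Ideal.liesOver_span_iff Ideal.IsPrime.ne_top' (Nat.prime_iff_prime_int.mp hℓ.out),
    map_natCast]

variable {E : Type*} [Field E] [NumberField E]

theorem isMaximal_of_liesOver (P : Ideal (𝓞 E)) [P.IsPrime] [P.LiesOver (Ideal.span {(ℓ : ℤ)})] :
    P.IsMaximal :=
  Ideal.IsPrime.isMaximal inferInstance
    (Ideal.ne_bot_of_liesOver_of_ne_bot (p := Ideal.span {(ℓ : ℤ)}) span_natCast_ne_bot P)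

theorem finite_quotient_of_liesOver (P : Ideal (𝓞 E)) [P.IsPrime]
    [P.LiesOver (Ideal.span {(ℓ : ℤ)})] : Finite (𝓞 E ⧸ P) :=
  Ideal.finiteQuotientOfFreeOfNeBot P
    (Ideal.ne_bot_of_liesOver_of_ne_bot (p := Ideal.span {(ℓ : ℤ)}) span_natCast_ne_bot P)

theorem isUnramifiedIn_iff_inertia_eq_bot [IsGalois ℚ E] (P : Ideal (𝓞 E)) [P.IsPrime]
    [P.LiesOver (Ideal.span {(ℓ : ℤ)})] :
    IsUnramifiedIn E ℓ ↔ P.inertia (E ≃ₐ[ℚ] E) = ⊥ := by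
  rw [← Subgroup.card_eq_one, Ideal.card_inertia_eq_ramificationIdxIn (Ideal.span {(ℓ : ℤ)}) P,
    Ideal.ramificationIdxIn_eq_ramificationIdx (Ideal.span {(ℓ : ℤ)}) P (E ≃ₐ[ℚ] E)]
  refine ⟨fun h => Ideal.ramificationIdx_eq_one_iff.2 (h P inferInstance), fun h Q _ hQ => ?_⟩
  rw [← Ideal.ramificationIdx_eq_one_iff, ← h]
  exact Ideal.ramificationIdx_eq_of_isGaloisGroup (Ideal.span {(ℓ : ℤ)}) Q P (E ≃ₐ[ℚ] E)

theorem pow_mem_inertia_iff {P : Ideal (𝓞 E)} [P.IsPrime] [P.LiesOver (Ideal.span {(ℓ : ℤ)})]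
    {F : E ≃ₐ[ℚ] E} (hF : IsArithFrobAt ℤ F P) (n : ℕ) :
    F ^ n ∈ P.inertia (E ≃ₐ[ℚ] E) ↔ P.inertiaDeg ℤ ∣ n := by
  have := isMaximal_of_liesOver (ℓ := ℓ) P
  have := finite_quotient_of_liesOver (ℓ := ℓ) P
  let _ : Field (𝓞 E ⧸ P) := Ideal.Quotient.field P
  let _ : Field (ℤ ⧸ P.under ℤ) := Ideal.Quotient.field _
  have hcard := natCard_int_quotient_under P ℓ
  have : Finite (ℤ ⧸ P.under ℤ) := Nat.finite_of_card_ne_zero (hcard ▸ hℓ.out.ne_zero)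
  have := Fintype.ofFinite (ℤ ⧸ P.under ℤ)
  have hfrob (y : 𝓞 E ⧸ P) :
      (FiniteField.frobeniusAlgHom (ℤ ⧸ P.under ℤ) (𝓞 E ⧸ P) ^ n) y = y ^ ℓ ^ n := by
    rw [AlgHom.coe_pow, FiniteField.coe_frobeniusAlgHom, pow_iterate,
      ← Nat.card_eq_fintype_card, hcard]
  rw [Ideal.inertiaDeg_eq_of_isMaximal (P.under ℤ) P, ← FiniteField.orderOf_frobeniusAlgHom,
    orderOf_dvd_iff_pow_eq_one, AlgHom.ext_iff, Ideal.Quotient.mk_surjective.forall]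
  refine forall_congr' fun x => ?_
  rw [hfrob, ← mk_pow_smul_of_isArithFrobAt hF, AlgHom.one_apply, Ideal.Quotient.eq]
  exact Iff.rfl

variable [IsGalois ℚ E] {K : Type*} [Field K] [NumberField K] [IsGalois ℚ K] [Algebra E K]

open IsGaloisGroup

variable (E K) in
/-- Restriction of automorphisms of `K` to a Galois subfield `E`, in the form for which the actions
on rings of integers are compatible. -/
abbrev resHom : (K ≃ₐ[ℚ] K) →* (E ≃ₐ[ℚ] E) :=
  restrictHom (K ≃ₐ[ℚ] K) (E ≃ₐ[ℚ] E) ℤ (𝓞 E) (𝓞 K)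

theorem algebraMap_resHom (σ : K ≃ₐ[ℚ] K) (x : E) :
    algebraMap E K (resHom E K σ x) = σ (algebraMap E K x) := by
  have hint (a : 𝓞 E) : algebraMap E K (resHom E K σ (algebraMap (𝓞 E) E a)) =
      σ (algebraMap E K (algebraMap (𝓞 E) E a)) :=
    congrArg (algebraMap (𝓞 K) K) (algebraMap_restrictHom_smul (K ≃ₐ[ℚ] K)
      (E ≃ₐ[ℚ] E) ℤ (𝓞 E) (𝓞 K) σ a)
  obtain ⟨a, b, -, rfl⟩ := IsFractionRing.div_surjective (A := 𝓞 E) x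
  simp only [map_div₀, hint]

theorem mem_ker_resHom_iff (σ : K ≃ₐ[ℚ] K) :
    σ ∈ (resHom E K).ker ↔ ∀ x : E, σ (algebraMap E K x) = algebraMap E K x := by
  rw [MonoidHom.mem_ker, AlgEquiv.ext_iff]
  refine forall_congr' fun x => ?_
  rw [← algebraMap_resHom, AlgEquiv.one_apply, (algebraMap E K).injective.eq_iff]

theorem resHom_surjective : Function.Surjective (resHom E K) :=
  restrictHom_surjective _ _ _ _ _

theorem isArithFrobAt_resHom {P : Ideal (𝓞 K)} {F : K ≃ₐ[ℚ] K} (hF : IsArithFrobAt ℤ F P) :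
    IsArithFrobAt ℤ (resHom E K F) (P.under (𝓞 E)) := by
  intro x
  rw [Ideal.under_under (B := 𝓞 E) P]
  change algebraMap (𝓞 E) (𝓞 K) (resHom E K F • x - x ^ _) ∈ P
  rw [map_sub, algebraMap_restrictHom_smul, map_pow]
  exact hF _

theorem map_resHom_inertia_le (P : Ideal (𝓞 K)) :
    (P.inertia (K ≃ₐ[ℚ] K)).map (resHom E K) ≤ (P.under (𝓞 E)).inertia (E ≃ₐ[ℚ] E) := by
  rintro _ ⟨σ, hσ, rfl⟩ x
  change algebraMap (𝓞 E) (𝓞 K) (resHom E K σ • x - x) ∈ P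
  rw [map_sub, algebraMap_restrictHom_smul]
  exact hσ _

theorem natCard_inertia_le (P : Ideal (𝓞 K)) :
    Nat.card (P.inertia (K ≃ₐ[ℚ] K)) ≤
      Nat.card (P.inertia (K ≃ₐ[E] K)) * Nat.card ((P.inertia (K ≃ₐ[ℚ] K)).map (resHom E K)) := by
  let r := (resHom E K).domRestrict (P.inertia (K ≃ₐ[ℚ] K))
  have hfix (σ : r.ker) : ∀ x : E, σ.1.1 (algebraMap E K x) = algebraMap E K x :=
    (mem_ker_resHom_iff _).1 (show resHom E K σ.1.1 = 1 from σ.2)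
  let toRelative (σ : r.ker) : P.inertia (K ≃ₐ[E] K) :=
    ⟨AlgEquiv.ofRingEquiv (f := σ.1.1.toRingEquiv) (hfix σ), fun x => σ.1.2 x⟩
  have hker : Nat.card r.ker ≤ Nat.card (P.inertia (K ≃ₐ[E] K)) :=
    Nat.card_le_card_of_injective toRelative fun σ τ h =>
      Subtype.ext (Subtype.ext (AlgEquiv.ext fun x =>
        congrArg (fun g : P.inertia (K ≃ₐ[E] K) => g.1 x) h))
  rw [← MonoidHom.domRestrict_range, ← Subgroup.card_mul_index r.ker, Subgroup.index_ker]
  exact Nat.mul_le_mul_right _ hker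

theorem map_resHom_inertia (P : Ideal (𝓞 K)) [P.IsPrime] [P.LiesOver (Ideal.span {(ℓ : ℤ)})] :
    (P.inertia (K ≃ₐ[ℚ] K)).map (resHom E K) = (P.under (𝓞 E)).inertia (E ≃ₐ[ℚ] E) := by
  have : IsGalois E K := IsGalois.tower_top_of_isGalois ℚ E K
  have : Nonempty ((P.under (𝓞 E)).primesOver (𝓞 K)) := ⟨P, inferInstance, inferInstance⟩
  have hmul := Ideal.ramificationIdxIn_mul_ramificationIdxIn (p := Ideal.span {(ℓ : ℤ)})
    (P.under (𝓞 E)) (E ≃ₐ[ℚ] E) (𝓞 K) (K ≃ₐ[ℚ] K) (K ≃ₐ[E] K)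
  rw [← Ideal.card_inertia_eq_ramificationIdxIn (G := K ≃ₐ[ℚ] K) (Ideal.span {(ℓ : ℤ)}) P,
    ← Ideal.card_inertia_eq_ramificationIdxIn (G := E ≃ₐ[ℚ] E) (Ideal.span {(ℓ : ℤ)})
      (P.under (𝓞 E)),
    ← Ideal.card_inertia_eq_ramificationIdxIn (G := K ≃ₐ[E] K) (P.under (𝓞 E)) P, mul_comm] at hmul
  refine Subgroup.eq_of_le_of_card_ge (map_resHom_inertia_le P) (Nat.le_of_mul_le_mul_left ?_
    (Nat.card_pos (α := P.inertia (K ≃ₐ[E] K))))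
  exact hmul.trans_le (natCard_inertia_le P)

end Galois

/-! ### Products over characters of finite abelian groups -/

section Characters

theorem finprod_comp_of_surjective {A B M : Type*} [Group A] [Finite A] [Group B] [CommMonoid M]
    {φ : A →* B} (hφ : Function.Surjective φ) (f : B → M) :
    ∏ᶠ a, f (φ a) = (∏ᶠ b, f b) ^ Nat.card φ.ker := by
  classical
  have := Finite.of_surjective φ hφ
  have := Fintype.ofFinite A
  have := Fintype.ofFinite B
  have hfiber (b : B) : (Finset.univ.filter fun a => φ a = b).card = Nat.card φ.ker := by
    rw [MonoidHom.card_fiber_eq_of_mem_range φ (hφ b) (hφ 1), ← Fintype.card_subtype,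
      ← Nat.card_eq_fintype_card]
    rfl
  rw [finprod_eq_prod_of_fintype, finprod_eq_prod_of_fintype, ← Finset.prod_fiberwise _ φ,
    ← Finset.prod_pow]
  refine Finset.prod_congr rfl fun b _ => ?_
  rw [← hfiber b]
  exact Finset.prod_eq_pow_card fun a ha => congrArg f (Finset.mem_filter.1 ha).2

theorem finprod_rootsOfUnity_one_sub_mul (n : ℕ) [NeZero n] (x : ℂ) :
    ∏ᶠ ζ : rootsOfUnity n ℂ, (1 - (ζ : ℂˣ) * x) = 1 - x ^ n := by
  have hprod := (Complex.isPrimitiveRoot_exp n (NeZero.ne n)).pow_sub_pow_eq_prod_sub_mul 1 x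
    (NeZero.pos n)
  have := Fintype.ofFinite (rootsOfUnity n ℂ)
  rw [one_pow] at hprod
  rw [hprod, finprod_eq_prod_of_fintype]
  refine Finset.prod_bij (fun ζ _ => ((ζ : ℂˣ) : ℂ)) (fun ζ _ => ?_)
    (fun ζ _ ξ _ h => Subtype.ext (Units.ext h)) (fun z hz => ?_) fun _ _ => rfl
  · exact (mem_nthRootsFinset (NeZero.pos n) 1).2 ((mem_rootsOfUnity' n _).1 ζ.2)
  · exact ⟨rootsOfUnity.mkOfPowEq z ((mem_nthRootsFinset (NeZero.pos n) 1).1 hz),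
      Finset.mem_univ _, rfl⟩

variable {G : Type*} [CommGroup G] [Finite G]

/-- Evaluation of characters at `F`, as a homomorphism to the roots of unity of order dividing the
order of `F`. -/
def evalCharacter (F : G) : (G →* ℂˣ) →* rootsOfUnity (orderOf F) ℂ :=
  (MonoidHom.eval F).codRestrict _ fun χ => by
    rw [mem_rootsOfUnity, MonoidHom.eval_apply_apply, ← map_pow, pow_orderOf_eq_one, map_one]

theorem evalCharacter_surjective (F : G) : Function.Surjective (evalCharacter F) := by
  have : NeZero (orderOf F) := ⟨(orderOf_pos F).ne'⟩
  have hpow (χ : G →* ℂˣ) : χ (F ^ Nat.card (evalCharacter F).range) = χ 1 := by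
    have h : (evalCharacter F).rangeRestrict χ ^ Nat.card (evalCharacter F).range = 1 :=
      pow_card_eq_one'
    rw [map_pow, map_one]
    exact congrArg (fun u => (u.1.1 : ℂˣ)) h
  rw [← MonoidHom.range_eq_top]
  refine Subgroup.eq_top_of_le_card _ ?_
  rw [Complex.card_rootsOfUnity]
  exact Nat.le_of_dvd Nat.card_pos (orderOf_dvd_of_pow_eq_one
    ((CommGroup.forall_apply_eq_apply_iff (G := G) (M := ℂ)).1 hpow))

theorem natCard_ker_evalCharacter (F : G) :
    Nat.card (evalCharacter F).ker = (Subgroup.zpowers F).index := by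
  have : NeZero (orderOf F) := ⟨(orderOf_pos F).ne'⟩
  have hcard := Subgroup.card_mul_index (evalCharacter F).ker
  rw [Subgroup.index_ker, MonoidHom.range_eq_top.2 (evalCharacter_surjective F),
    Subgroup.card_top,
    Complex.card_rootsOfUnity, CommGroup.card_monoidHom_of_hasEnoughRootsOfUnity,
    ← Subgroup.card_mul_index (Subgroup.zpowers F), Nat.card_zpowers, mul_comm] at hcard
  exact Nat.eq_of_mul_eq_mul_left (orderOf_pos F) hcard

theorem finprod_one_sub_character_mul (F : G) (x : ℂ) :
    ∏ᶠ χ : G →* ℂˣ, (1 - (χ F : ℂ) * x) =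
      (1 - x ^ orderOf F) ^ (Subgroup.zpowers F).index := by
  have : NeZero (orderOf F) := ⟨(orderOf_pos F).ne'⟩
  rw [← finprod_rootsOfUnity_one_sub_mul, ← natCard_ker_evalCharacter]
  exact finprod_comp_of_surjective (evalCharacter_surjective F) fun ζ => 1 - (ζ : ℂˣ) * x

theorem finprod_mem_ker_le {G H M A : Type*} [Group G] [Group H] [CommGroup A] [CommMonoid M]
    {r : G →* H} (hr : Function.Surjective r) (f : (G →* A) → M) :
    ∏ᶠ χ ∈ {χ : G →* A | r.ker ≤ χ.ker}, f χ = ∏ᶠ ψ : H →* A, f (ψ.comp r) := by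
  have hrange : {χ : G →* A | r.ker ≤ χ.ker} = Set.range fun ψ : H →* A => ψ.comp r := by
    ext χ
    constructor
    · exact fun h => ⟨r.liftOfSurjective hr ⟨χ, h⟩, MonoidHom.ext fun g => by simp⟩
    · rintro ⟨ψ, rfl⟩ g hg
      rw [MonoidHom.mem_ker, MonoidHom.comp_apply, MonoidHom.mem_ker.1 hg, map_one]
  rw [hrange]
  exact finprod_mem_range fun ψ ψ' h => (MonoidHom.cancel_right hr).1 h

end Characters

/-! ### Units of finite quotients -/

theorem natCard_units_mul_natCard_of_isLocalHom {A B : Type*} [CommRing A] [Finite A] [CommRing B]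
    (φ : A →+* B) (hφ : Function.Surjective φ) [hloc : IsLocalHom φ] :
    Nat.card Aˣ * Nat.card B = Nat.card Bˣ * Nat.card A := by
  have := Finite.of_surjective φ hφ
  let ψ : Aˣ →* Bˣ := Units.map φ
  have hψ : Function.Surjective ψ := IsLocalRing.surjective_units_map_of_local_ringHom φ hφ hloc
  have hunit (x : RingHom.ker φ) : IsUnit (1 + x.1) :=
    isUnit_of_map_unit φ _ (by
      rw [map_add, map_one, (RingHom.mem_ker).1 x.2, add_zero]
      exact isUnit_one)
  let e : ψ.ker ≃ RingHom.ker φ :=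
    { toFun := fun u => ⟨u.1 - 1, by
        rw [RingHom.mem_ker, map_sub, map_one, sub_eq_zero]
        exact congrArg Units.val u.2⟩
      invFun := fun x => ⟨(hunit x).unit, Units.ext (by
        change φ (1 + x.1) = 1
        rw [map_add, map_one, (RingHom.mem_ker).1 x.2, add_zero])⟩
      left_inv := fun u => Subtype.ext (Units.ext (add_sub_cancel 1 _))
      right_inv := fun x => Subtype.ext (add_sub_cancel_left 1 _) }
  have hA : Nat.card A = Nat.card (RingHom.ker φ) * Nat.card B := by
    rw [← AddSubgroup.card_mul_index φ.toAddMonoidHom.ker, AddSubgroup.index_ker,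
      AddMonoidHom.range_eq_top.2 hφ, AddSubgroup.card_top]
    rfl
  have hU : Nat.card Aˣ = Nat.card ψ.ker * Nat.card Bˣ := by
    rw [← Subgroup.card_mul_index ψ.ker, Subgroup.index_ker, MonoidHom.range_eq_top.2 hψ,
      Subgroup.card_top]
  rw [hA, hU, Nat.card_congr e]
  ring

section Units

variable {O : Type*} [CommRing O]

theorem isLocalHom_pi_factor (I : Ideal O) {ι : Type*} (P : ι → Ideal O) (hle : ∀ i, I ≤ P i)
    (hall : ∀ m : Ideal O, m.IsMaximal → I ≤ m → ∃ i, P i = m) :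
    IsLocalHom (RingHom.pi fun i => Ideal.Quotient.factor (hle i)) := by
  refine ⟨fun a ha => ?_⟩
  obtain ⟨x, rfl⟩ := Ideal.Quotient.mk_surjective a
  by_contra hx
  obtain ⟨m, hm, hxm⟩ := exists_max_ideal_of_mem_nonunits hx
  have hIm : I ≤ m.comap (Ideal.Quotient.mk I) := fun y hy => by
    rw [Ideal.mem_comap, Ideal.Quotient.eq_zero_iff_mem.2 hy]
    exact m.zero_mem
  have hmax :=
    Ideal.comap_isMaximal_of_surjective (K := m) _ (Ideal.Quotient.mk_surjective (I := I))
  obtain ⟨i, hi⟩ := hall _ hmax hIm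
  have : Nontrivial (O ⧸ P i) := Ideal.Quotient.nontrivial_iff.2 (hi ▸ hmax.ne_top)
  have hxi : Ideal.Quotient.mk (P i) x = 0 := by
    rw [Ideal.Quotient.eq_zero_iff_mem, hi]
    exact hxm
  exact (ha.map (Pi.evalRingHom (fun i => O ⧸ P i) i)).ne_zero hxi

theorem natCard_units_eq_of_field (k : Type*) [Field k] [Finite k] :
    (Nat.card kˣ : ℚ) = Nat.card k * (1 - (Nat.card k : ℚ)⁻¹) := by
  have hne : (Nat.card k : ℚ) ≠ 0 := mod_cast Nat.card_pos.ne'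
  rw [mul_sub, mul_inv_cancel₀ hne, mul_one, Nat.card_eq_card_units_add_one (α := k),
    Nat.cast_add_one, add_sub_cancel_right]

theorem natCard_units_quotient (I : Ideal O) [Finite (O ⧸ I)] (s : Finset (Ideal O))
    (hs : ∀ m, m ∈ s ↔ m.IsMaximal ∧ I ≤ m) :
    (Nat.card (O ⧸ I)ˣ : ℚ) = Nat.card (O ⧸ I) * ∏ m ∈ s, (1 - (Nat.card (O ⧸ m) : ℚ)⁻¹) := by
  have hmax (m : s) : m.1.IsMaximal := ((hs m).1 m.2).1
  have hle (m : s) : I ≤ m.1 := ((hs m).1 m.2).2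
  have (m : s) : Finite (O ⧸ m.1) :=
    Finite.of_surjective _ (Ideal.Quotient.factor_surjective (hle m))
  let π : (O ⧸ I) →+* ∀ m : s, O ⧸ m.1 := RingHom.pi fun m => Ideal.Quotient.factor (hle m)
  have hπ : Function.Surjective π := fun y => by
    obtain ⟨x, hx⟩ := Ideal.pi_quotient_surjective (I := fun m : s => m.1)
      (fun m n hmn => Ideal.isCoprime_of_isMaximal fun h => hmn (Subtype.ext h)) y
    exact ⟨Ideal.Quotient.mk I x, funext hx⟩
  have hloc : IsLocalHom π :=
    isLocalHom_pi_factor I _ hle fun m hm hIm => ⟨⟨m, (hs m).2 ⟨hm, hIm⟩⟩, rfl⟩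
  have hcount : (Nat.card (O ⧸ I)ˣ : ℚ) * ∏ m : s, (Nat.card (O ⧸ m.1) : ℚ) =
      (∏ m : s, (Nat.card (O ⧸ m.1)ˣ : ℚ)) * Nat.card (O ⧸ I) := by
    have h := natCard_units_mul_natCard_of_isLocalHom π hπ
    rw [Nat.card_congr (MulEquiv.piUnits (M := fun m : s => O ⧸ m.1)).toEquiv, Nat.card_pi,
      Nat.card_pi] at h
    exact mod_cast h
  have hunits (m : s) : (Nat.card (O ⧸ m.1)ˣ : ℚ) =
      Nat.card (O ⧸ m.1) * (1 - (Nat.card (O ⧸ m.1) : ℚ)⁻¹) := by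
    let _ : Field (O ⧸ m.1) := Ideal.Quotient.field m.1
    exact natCard_units_eq_of_field (O ⧸ m.1)
  have hne : ∏ m : s, (Nat.card (O ⧸ m.1) : ℚ) ≠ 0 :=
    Finset.prod_ne_zero_iff.2 fun m _ => mod_cast Nat.card_pos.ne'
  rw [← Finset.prod_coe_sort]
  refine mul_right_cancel₀ hne (hcount.trans ?_)
  rw [Finset.prod_congr rfl fun m _ => hunits m, Finset.prod_mul_distrib]
  ring

end Units

/-! ### Euler factors of abelian fields -/

section EulerFactor

variable {ℓ : ℕ} [hℓ : Fact ℓ.Prime] {E : Type*} [Field E] [NumberField E]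

theorem natCard_quotient_span_natCast (ℓ : ℕ) (E : Type*) [Field E] [NumberField E] :
    Nat.card (𝓞 E ⧸ Ideal.span {(ℓ : 𝓞 E)}) = ℓ ^ Module.finrank ℚ E := by
  rw [← Submodule.cardQuot_apply, ← Ideal.absNorm_apply, Ideal.absNorm_span_natCast,
    RingOfIntegers.rank]

variable (E ℓ) in
theorem finite_quotient_span_natCast : Finite (𝓞 E ⧸ Ideal.span {(ℓ : 𝓞 E)}) :=
  Nat.finite_of_card_ne_zero (by
    rw [natCard_quotient_span_natCast]
    exact pow_ne_zero _ hℓ.out.ne_zero)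

theorem mem_primesOver_span_natCast_iff (m : Ideal (𝓞 E)) :
    m ∈ (Ideal.span {(ℓ : ℤ)}).primesOver (𝓞 E) ↔
      m.IsMaximal ∧ Ideal.span {(ℓ : 𝓞 E)} ≤ m := by
  rw [Ideal.span_le, Set.singleton_subset_iff]
  constructor
  · rintro ⟨_, hm⟩
    exact ⟨isMaximal_of_liesOver (ℓ := ℓ) m, (liesOver_span_natCast_iff m).1 hm⟩
  · rintro ⟨hm, hℓm⟩
    exact ⟨hm.isPrime, (liesOver_span_natCast_iff m).2 hℓm⟩

theorem natCard_units_quotient_span_natCast [IsGalois ℚ E] (P : Ideal (𝓞 E)) [P.IsPrime]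
    [P.LiesOver (Ideal.span {(ℓ : ℤ)})] :
    (Nat.card (𝓞 E ⧸ Ideal.span {(ℓ : 𝓞 E)})ˣ : ℚ) = ℓ ^ Module.finrank ℚ E *
      (1 - (ℓ : ℚ)⁻¹ ^ P.inertiaDeg ℤ) ^ ((Ideal.span {(ℓ : ℤ)}).primesOver (𝓞 E)).ncard := by
  have := finite_quotient_span_natCast ℓ E
  have hfin : ((Ideal.span {(ℓ : ℤ)}).primesOver (𝓞 E)).Finite :=
    Algebra.QuasiFinite.finite_primesOver _
  have hfactor (Q) (hQ : Q ∈ hfin.toFinset) :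
      1 - (Nat.card (𝓞 E ⧸ Q) : ℚ)⁻¹ = 1 - (ℓ : ℚ)⁻¹ ^ P.inertiaDeg ℤ := by
    obtain ⟨_, _⟩ := hfin.mem_toFinset.1 hQ
    rw [natCard_quotient_of_liesOver Q ℓ, Nat.cast_pow, inv_pow,
      Ideal.inertiaDeg_eq_of_isGaloisGroup (Ideal.span {(ℓ : ℤ)}) Q P (E ≃ₐ[ℚ] E)]
  rw [natCard_units_quotient _ hfin.toFinset fun m => by
      rw [hfin.mem_toFinset, mem_primesOver_span_natCast_iff],
    natCard_quotient_span_natCast, Nat.cast_pow, Finset.prod_congr rfl hfactor, Finset.prod_const,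
    Set.ncard_eq_toFinset_card _ hfin]

variable {K : Type*} [Field K] [NumberField K]

theorem ker_resHom_fixedField [IsGalois ℚ K] (N : Subgroup (K ≃ₐ[ℚ] K)) [N.Normal]
    [IsGalois ℚ (IntermediateField.fixedField N)] :
    (resHom (IntermediateField.fixedField N) K).ker = N := by
  ext σ
  rw [mem_ker_resHom_iff]
  conv_rhs => rw [← IntermediateField.fixingSubgroup_fixedField N]
  rw [IntermediateField.mem_fixingSubgroup_iff]
  exact ⟨fun h x hx => h ⟨x, hx⟩, fun h x => h x.1 x.2⟩

theorem isUnramifiedIn_charField_iff [IsGalois ℚ K] (χ : (K ≃ₐ[ℚ] K) →* ℂˣ) (P : Ideal (𝓞 K))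
    [P.IsPrime] [P.LiesOver (Ideal.span {(ℓ : ℤ)})] :
    IsUnramifiedIn (charField χ) ℓ ↔ P.inertia (K ≃ₐ[ℚ] K) ≤ χ.ker := by
  have : IsGalois ℚ (charField χ) := IsGalois.of_fixedField_normal_subgroup χ.ker
  rw [isUnramifiedIn_iff_inertia_eq_bot (P.under (𝓞 (charField χ))),
    ← map_resHom_inertia (ℓ := ℓ), Subgroup.map_eq_bot_iff, ker_resHom_fixedField]

theorem apply_eq_of_restrictsToFrob [IsAbelianGalois ℚ K] {χ : (K ≃ₐ[ℚ] K) →* ℂˣ}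
    {P : Ideal (𝓞 K)} [P.IsPrime] [P.LiesOver (Ideal.span {(ℓ : ℤ)})] {F σ : K ≃ₐ[ℚ] K}
    (hF : IsArithFrobAt ℤ F P) (hσ : RestrictsToFrob (charField χ) ℓ σ)
    (hχ : P.inertia (K ≃ₐ[ℚ] K) ≤ χ.ker) : χ σ = χ F := by
  have : IsAbelianGalois ℚ (charField χ) := IsAbelianGalois.tower_bot ℚ (charField χ) K
  obtain ⟨τ, hτ, Q, hQ, hQℓ, hτQ⟩ := hσ
  have hστ : resHom (charField χ) K σ = τ :=
    AlgEquiv.ext fun x => Subtype.ext ((algebraMap_resHom σ x).trans (hτ x).symm)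
  obtain ⟨g, hg⟩ := Ideal.exists_smul_eq_of_isGaloisGroup (Ideal.span {(ℓ : ℤ)})
    (P.under (𝓞 (charField χ))) Q (charField χ ≃ₐ[ℚ] charField χ)
  have hFQ := (isArithFrobAt_resHom (E := charField χ) hF).conj g
  rw [hg, mul_comm' g, mul_inv_cancel_right] at hFQ
  have hmem := hτQ.mul_inv_mem_inertia hFQ
  rw [(isUnramifiedIn_iff_inertia_eq_bot Q).1 ((isUnramifiedIn_charField_iff (ℓ := ℓ) χ P).2 hχ),
    Subgroup.mem_bot, ← hστ, ← map_inv, ← map_mul, ← MonoidHom.mem_ker, ker_resHom_fixedField,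
    MonoidHom.mem_ker, map_mul, map_inv, mul_inv_eq_one] at hmem
  exact hmem

open Classical in
theorem charValue_eq [IsAbelianGalois ℚ K] (χ : (K ≃ₐ[ℚ] K) →* ℂˣ) {P : Ideal (𝓞 K)} [P.IsPrime]
    [P.LiesOver (Ideal.span {(ℓ : ℤ)})] {F : K ≃ₐ[ℚ] K} (hF : IsArithFrobAt ℤ F P) :
    charValue χ ℓ = if P.inertia (K ≃ₐ[ℚ] K) ≤ χ.ker then (χ F : ℂ) else 0 := by
  rw [charValue, isUnramifiedIn_charField_iff χ P]
  split_ifs with hχ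
  · rw [apply_eq_of_restrictsToFrob hF (exists_restrictsToFrob χ ℓ).choose_spec hχ]
  · rfl

variable (ℓ K) in
theorem exists_isArithFrobAt [IsGalois ℚ K] : ∃ (P : Ideal (𝓞 K)) (F : K ≃ₐ[ℚ] K),
    P.IsPrime ∧ P.LiesOver (Ideal.span {(ℓ : ℤ)}) ∧ IsArithFrobAt ℤ F P := by
  obtain ⟨P, _, _⟩ := Ideal.exists_maximal_ideal_liesOver_of_isIntegral (S := 𝓞 K)
    (Ideal.span {(ℓ : ℤ)})
  have := finite_quotient_of_liesOver (ℓ := ℓ) P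
  obtain ⟨F, hF⟩ := IsArithFrobAt.exists_of_isInvariant ℤ (K ≃ₐ[ℚ] K) P
  exact ⟨P, F, inferInstance, inferInstance, hF⟩

theorem charValue_comp_resHom [IsAbelianGalois ℚ E] [IsAbelianGalois ℚ K] [Algebra E K]
    (ψ : (E ≃ₐ[ℚ] E) →* ℂˣ) : charValue (ψ.comp (resHom E K)) ℓ = charValue ψ ℓ := by
  classical
  obtain ⟨P, F, _, _, hF⟩ := exists_isArithFrobAt ℓ K
  rw [charValue_eq _ hF, charValue_eq _ (isArithFrobAt_resHom (E := E) hF),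
    ← map_resHom_inertia (ℓ := ℓ), Subgroup.map_le_iff_le_comap]
  rfl

theorem inertiaDeg_mul_ncard_primesOver [IsGalois ℚ E] (P : Ideal (𝓞 E)) [P.IsPrime]
    [P.LiesOver (Ideal.span {(ℓ : ℤ)})] :
    P.inertiaDeg ℤ * ((Ideal.span {(ℓ : ℤ)}).primesOver (𝓞 E)).ncard =
      (P.inertia (E ≃ₐ[ℚ] E)).index := by
  have hcard := Ideal.ncard_primesOver_mul_card_inertia_mul_finrank (G := E ≃ₐ[ℚ] E)
    (Ideal.span {(ℓ : ℤ)}) P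
  rw [← Subgroup.card_mul_index (P.inertia (E ≃ₐ[ℚ] E))] at hcard
  refine Nat.eq_of_mul_eq_mul_left (Nat.card_pos (α := P.inertia (E ≃ₐ[ℚ] E)))
    (Eq.trans ?_ hcard)
  ring

section Abelian

open scoped IsMulCommutative

variable [IsAbelianGalois ℚ E] {P : Ideal (𝓞 E)} [P.IsPrime] {F : E ≃ₐ[ℚ] E}

theorem orderOf_mk_inertia [P.LiesOver (Ideal.span {(ℓ : ℤ)})] (hF : IsArithFrobAt ℤ F P) :
    orderOf (F : (E ≃ₐ[ℚ] E) ⧸ P.inertia (E ≃ₐ[ℚ] E)) = P.inertiaDeg ℤ :=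
  Nat.dvd_right_iff_eq.1 fun n => by
    rw [orderOf_dvd_iff_pow_eq_one, ← QuotientGroup.mk_pow, QuotientGroup.eq_one_iff,
      pow_mem_inertia_iff (ℓ := ℓ) hF]

theorem index_zpowers_mk_inertia [P.LiesOver (Ideal.span {(ℓ : ℤ)})] (hF : IsArithFrobAt ℤ F P) :
    (Subgroup.zpowers (F : (E ≃ₐ[ℚ] E) ⧸ P.inertia (E ≃ₐ[ℚ] E))).index =
      ((Ideal.span {(ℓ : ℤ)}).primesOver (𝓞 E)).ncard := by
  refine Nat.eq_of_mul_eq_mul_left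
    (orderOf_pos (F : (E ≃ₐ[ℚ] E) ⧸ P.inertia (E ≃ₐ[ℚ] E))) ?_
  rw [← Nat.card_zpowers, Subgroup.card_mul_index, Nat.card_zpowers,
    orderOf_mk_inertia (ℓ := ℓ) hF, inertiaDeg_mul_ncard_primesOver, Subgroup.index]

theorem finprod_one_sub_charValue :
    ∏ᶠ χ : (E ≃ₐ[ℚ] E) →* ℂˣ, (1 - charValue χ ℓ / ℓ) =
      Nat.card (𝓞 E ⧸ Ideal.span {(ℓ : 𝓞 E)})ˣ / (ℓ : ℂ) ^ Module.finrank ℚ E := by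
  classical
  obtain ⟨P, F, _, _, hF⟩ := exists_isArithFrobAt ℓ E
  let π := QuotientGroup.mk' (P.inertia (E ≃ₐ[ℚ] E))
  have hfactor (χ : (E ≃ₐ[ℚ] E) →* ℂˣ) : 1 - charValue χ ℓ / ℓ =
      ∏ᶠ _ : χ ∈ {χ : (E ≃ₐ[ℚ] E) →* ℂˣ | π.ker ≤ χ.ker}, (1 - χ F * (ℓ : ℂ)⁻¹) := by
    have hmem : χ ∈ {χ : (E ≃ₐ[ℚ] E) →* ℂˣ | π.ker ≤ χ.ker} ↔
        P.inertia (E ≃ₐ[ℚ] E) ≤ χ.ker := by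
      rw [Set.mem_ofPred_eq, QuotientGroup.ker_mk']
    simp only [charValue_eq χ hF, finprod_eq_if, hmem]
    split_ifs
    · rw [div_eq_mul_inv]
    · rw [zero_div, sub_zero]
  have hunits : (Nat.card (𝓞 E ⧸ Ideal.span {(ℓ : 𝓞 E)})ˣ : ℂ) = ℓ ^ Module.finrank ℚ E *
      (1 - (ℓ : ℂ)⁻¹ ^ P.inertiaDeg ℤ) ^ ((Ideal.span {(ℓ : ℤ)}).primesOver (𝓞 E)).ncard := by
    have h := congrArg (Rat.cast (K := ℂ)) (natCard_units_quotient_span_natCast (ℓ := ℓ) P)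
    push_cast at h
    exact h
  have hℓ0 : (ℓ : ℂ) ≠ 0 := mod_cast hℓ.out.ne_zero
  rw [hunits, mul_div_cancel_left₀ _ (pow_ne_zero _ hℓ0), ← orderOf_mk_inertia (ℓ := ℓ) hF,
    ← index_zpowers_mk_inertia (ℓ := ℓ) hF, finprod_congr hfactor]
  exact (finprod_mem_ker_le (A := ℂˣ) (QuotientGroup.mk'_surjective _)
      fun χ => 1 - χ F * (ℓ : ℂ)⁻¹).trans
    (finprod_one_sub_character_mul (F : (E ≃ₐ[ℚ] E) ⧸ P.inertia (E ≃ₐ[ℚ] E)) _)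

theorem one_sub_charValue_ne_zero (χ : (E ≃ₐ[ℚ] E) →* ℂˣ) : 1 - charValue χ ℓ / ℓ ≠ 0 := by
  intro hχ
  have := finite_quotient_span_natCast ℓ E
  have := Fintype.ofFinite ((E ≃ₐ[ℚ] E) →* ℂˣ)
  have hprod := finprod_one_sub_charValue (E := E) (ℓ := ℓ)
  rw [finprod_eq_prod_of_fintype, Finset.prod_eq_zero (Finset.mem_univ χ) hχ, eq_comm,
    div_eq_zero_iff] at hprod
  exact hprod.elim (mod_cast Nat.card_pos.ne') (pow_ne_zero _ (mod_cast hℓ.out.ne_zero))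

variable [IsAbelianGalois ℚ K]

theorem nuK_eq [Algebra E K] (hE : imagChars K = {χ | (resHom E K).ker ≤ χ.ker}ᶜ) :
    nuK K ℓ = (Nat.card (𝓞 E ⧸ Ideal.span {(ℓ : 𝓞 E)})ˣ / (ℓ : ℂ) ^ Module.finrank ℚ E) /
      (Nat.card (𝓞 K ⧸ Ideal.span {(ℓ : 𝓞 K)})ˣ / (ℓ : ℂ) ^ Module.finrank ℚ K) := by
  let s : Set ((K ≃ₐ[ℚ] K) →* ℂˣ) := {χ | (resHom E K).ker ≤ χ.ker}
  let L (χ : (K ≃ₐ[ℚ] K) →* ℂˣ) : ℂ := 1 - charValue χ ℓ / ℓ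
  have hreal : ∏ᶠ χ ∈ s, L χ = ∏ᶠ ψ : (E ≃ₐ[ℚ] E) →* ℂˣ, (1 - charValue ψ ℓ / ℓ) := by
    rw [finprod_mem_ker_le resHom_surjective]
    exact finprod_congr fun ψ => congrArg (fun z : ℂ => 1 - z / ℓ) (charValue_comp_resHom ψ)
  have hmul : (∏ᶠ χ ∈ s, L χ) * ∏ᶠ χ ∈ sᶜ, L χ = ∏ᶠ χ, L χ := by
    rw [← finprod_mem_union disjoint_compl_right s.toFinite sᶜ.toFinite, Set.union_compl_self,
      finprod_mem_univ]
  have hne : ∏ᶠ χ ∈ s, L χ ≠ 0 :=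
    finprod_mem_induction (· ≠ 0) one_ne_zero (fun _ _ => mul_ne_zero)
      fun χ _ => one_sub_charValue_ne_zero χ
  rw [nuK, hE, finprod_mem_inv_distrib _ sᶜ.toFinite, ← finprod_one_sub_charValue,
    ← finprod_one_sub_charValue, ← hreal, ← hmul, div_mul_cancel_left₀ hne]

end Abelian

end EulerFactor

/-! ### The field of a Weil quartic -/

section RootField

variable {q : ℕ} {f : ℤ[X]} {K : Type*} [Field K] [NumberField K] {ϖ : K}

theorem IsWeilQuartic.mul_conj_eq (hf : IsWeilQuartic q f) {z : ℂ} (hz : aeval z f = 0) :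
    z * starRingEnd ℂ z = q := by
  obtain ⟨-, -, α, β, hfac, -, hnorm⟩ := hf
  have hprod : (z - α 0) * (z - β 0) * ((z - α 1) * (z - β 1)) = 0 := by
    rw [← hz, aeval_def, eval₂_eq_eval_map]
    change _ = eval z (f.map (Int.castRingHom ℂ))
    rw [hfac]
    simp [Fin.prod_univ_two]
  have hnz : ‖z‖ = √(q : ℝ) := by
    simp only [mul_eq_zero, sub_eq_zero] at hprod
    obtain (rfl | rfl) | (rfl | rfl) := hprod
    exacts [(hnorm 0).1, (hnorm 0).2, (hnorm 1).1, (hnorm 1).2]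
  rw [Complex.mul_conj, Complex.normSq_eq_norm_sq, hnz, Real.sq_sqrt (Nat.cast_nonneg q),
    Complex.ofReal_natCast]

namespace IsRootField

variable (h : IsRootField f K ϖ)
include h

theorem map_mul_conj_eq (hf : IsWeilQuartic q f) (φ : K →+* ℂ) :
    φ ϖ * starRingEnd ℂ (φ ϖ) = q :=
  hf.mul_conj_eq (by
    change aeval (φ.toIntAlgHom ϖ) f = 0
    rw [aeval_algHom_apply, h.1, map_zero])

theorem minpoly_eq (hf : f.Monic) (hirr : Irreducible (f.map (Int.castRingHom ℚ))) :
    minpoly ℚ ϖ = f.map (Int.castRingHom ℚ) := by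
  refine (minpoly.eq_of_irreducible_of_monic hirr ?_ (hf.map _)).symm
  rw [← h.1]
  exact aeval_map_algebraMap ℚ ϖ f

theorem finrank_eq (hf : f.Monic) (hirr : Irreducible (f.map (Int.castRingHom ℚ))) :
    Module.finrank ℚ K = f.natDegree := by
  rw [← IntermediateField.finrank_top', ← h.2,
    IntermediateField.adjoin.finrank (Algebra.IsIntegral.isIntegral ϖ), h.minpoly_eq hf hirr,
    hf.natDegree_map]

theorem isTotallyComplex (hf : IsWeilQuartic q f)
    (hirr : Irreducible (f.map (Int.castRingHom ℚ))) : IsTotallyComplex K where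
  isComplex v := by
    rw [← InfinitePlace.not_isReal_iff_isComplex, InfinitePlace.isReal_iff]
    intro hreal
    have hsq : ϖ ^ 2 = q := v.embedding.injective (by
      rw [map_pow, map_natCast, ← h.map_mul_conj_eq hf v.embedding,
        ← ComplexEmbedding.conjugate_coe_eq, ComplexEmbedding.isReal_iff.mp hreal, sq])
    have hle := natDegree_le_natDegree (minpoly.min ℚ ϖ (monic_X_pow_sub_C (q : ℚ) two_ne_zero)
      (by simp [hsq]))
    rw [natDegree_X_pow_sub_C, h.minpoly_eq hf.1 hirr, hf.1.natDegree_map, hf.2.1] at hle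
    lia

end IsRootField

theorem isAbelianGalois_of_finrank_eq_prime_sq [IsGalois ℚ K] {p : ℕ} [Fact p.Prime]
    (h : Module.finrank ℚ K = p ^ 2) : IsAbelianGalois ℚ K where
  toIsMulCommutative := IsPGroup.isMulCommutative_of_card_eq_prime_sq
    (by rw [IsGalois.card_aut_eq_finrank, h])

theorem IsMaximalWeil.exists_adjoin_eq_top (h : IsMaximalWeil K ϖ) {ι : K ≃ₐ[ℚ] K}
    (hι : ∀ φ : K →+* ℂ, ComplexEmbedding.IsConj φ ι) :
    ∃ w : 𝓞 K, (w : K) = ϖ ∧ Algebra.adjoin ℤ {w, ι • w} = ⊤ := by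
  obtain ⟨φ⟩ : Nonempty (K →+* ℂ) := inferInstance
  have hadj : Algebra.adjoin ℤ {ϖ, ι ϖ} = integralClosure ℤ K := by
    refine Subalgebra.map_injective (f := φ.toIntAlgHom) φ.injective ?_
    rw [← h φ, AlgHom.map_adjoin, Set.image_pair]
    congr 2
    exact congrArg (fun z => ({z} : Set ℂ)) ((hι φ).eq ϖ)
  have hϖ : ϖ ∈ integralClosure ℤ K := hadj ▸ Algebra.subset_adjoin (Set.mem_insert _ _)
  let w : 𝓞 K := ⟨ϖ, hϖ⟩
  refine ⟨w, rfl, Subalgebra.map_injective (f := (algebraMap (𝓞 K) K).toIntAlgHom)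
    RingOfIntegers.coe_injective ?_⟩
  rw [AlgHom.map_adjoin, Set.image_pair, Algebra.map_top]
  refine hadj.trans (Subalgebra.ext fun x => ⟨fun hx => ⟨⟨x, hx⟩, rfl⟩, ?_⟩)
  rintro ⟨y, rfl⟩
  exact y.2

theorem imagChars_eq [IsGalois ℚ K] [IsGalois ℚ (maximalRealSubfield K)] :
    imagChars K = {χ | (resHom (maximalRealSubfield K) K).ker ≤ χ.ker}ᶜ :=
  Set.ext fun χ => not_congr <| forall_congr' fun σ => by
    rw [mem_ker_resHom_iff, MonoidHom.mem_ker, Subtype.forall]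
    rfl

end RootField

section CMField

variable {K : Type*} [Field K] [NumberField K] [IsCMField K] {ι : K ≃ₐ[ℚ] K}

variable (K) in
theorem two_mul_finrank_maximalRealSubfield :
    2 * Module.finrank ℚ (maximalRealSubfield K) = Module.finrank ℚ K := by
  rw [← Module.finrank_mul_finrank ℚ (maximalRealSubfield K) K,
    Algebra.IsQuadraticExtension.finrank_eq_two (maximalRealSubfield K) K, mul_comm]

variable (K) in
theorem exists_isConj : ∃ ι : K ≃ₐ[ℚ] K, ∀ φ : K →+* ℂ, ComplexEmbedding.IsConj φ ι :=
  ⟨(IsCMField.complexConj K).restrictScalars ℚ, fun φ => IsCMField.isConj_complexConj K φ⟩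

theorem smul_eq_ringOfIntegersComplexConj (hι : ∀ φ : K →+* ℂ, ComplexEmbedding.IsConj φ ι)
    (a : 𝓞 K) : ι • a = IsCMField.ringOfIntegersComplexConj K a := by
  obtain ⟨φ⟩ : Nonempty (K →+* ℂ) := inferInstance
  have h : ι = (IsCMField.complexConj K).restrictScalars ℚ :=
    (hι φ).ext (IsCMField.isConj_complexConj K φ)
  exact RingOfIntegers.ext congr($h a)

theorem smul_smul_self_of_isConj (hι : ∀ φ : K →+* ℂ, ComplexEmbedding.IsConj φ ι) (a : 𝓞 K) :
    ι • ι • a = a := by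
  rw [smul_eq_ringOfIntegersComplexConj hι, smul_eq_ringOfIntegersComplexConj hι]
  exact RingOfIntegers.ext (IsCMField.complexConj_apply_apply K (a : K))

theorem exists_algebraMap_eq_add_smul (hι : ∀ φ : K →+* ℂ, ComplexEmbedding.IsConj φ ι)
    (a : 𝓞 K) : ∃ s : 𝓞 (maximalRealSubfield K), algebraMap _ (𝓞 K) s = a + ι • a := by
  refine (IsCMField.ringOfIntegersComplexConj_eq_self_iff K _).mp ?_
  rw [← smul_eq_ringOfIntegersComplexConj hι, smul_add, smul_smul_self_of_isConj hι, add_comm]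

end CMField

theorem IsRootField.mul_smul_eq {K : Type*} [Field K] [NumberField K] {q : ℕ} {f : ℤ[X]} {w : 𝓞 K}
    (h : IsRootField f K (w : K)) (hf : IsWeilQuartic q f) {ι : K ≃ₐ[ℚ] K}
    (hι : ∀ φ : K →+* ℂ, ComplexEmbedding.IsConj φ ι) : w * ι • w = q := by
  obtain ⟨φ⟩ : Nonempty (K →+* ℂ) := inferInstance
  refine RingOfIntegers.ext (φ.injective ?_)
  have hw : φ (ι w) = starRingEnd ℂ (φ w) := (hι φ).eq (w : K)
  calc φ (w * ι w) = q := by rw [map_mul, hw, h.map_mul_conj_eq hf φ]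
    _ = φ ((q : 𝓞 K) : K) := (map_natCast (φ.comp (algebraMap (𝓞 K) K)) q).symm

theorem IsAdmissible.not_dvd {p q : ℕ} {f : ℤ[X]} {K : Type*} [Field K] [NumberField K] {ϖ : K}
    (h : IsAdmissible p q f K ϖ) (hp : p.Prime) {ℓ : ℕ} (hℓ : ℓ.Prime) (hne : ℓ ≠ p) : ¬ ℓ ∣ q := by
  obtain ⟨e, -, rfl⟩ := h.primePow
  exact fun hdvd => hne ((Nat.prime_dvd_prime_iff_eq hℓ hp).mp (hℓ.dvd_of_dvd_pow hdvd))

/-! ### Reduction modulo `ℓ` of the ring of integers -/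

section Reduction

variable (K : Type*) [Field K] (ℓ : ℕ) [hℓ : Fact ℓ.Prime]

/-- The reduction map `𝓞_K → κ(ℓ)`. -/
def reduction : 𝓞 K →+* Kappa K ℓ :=
  (Algebra.TensorProduct.includeRight : 𝓞 K →ₐ[ℤ] Kappa K ℓ)

variable {K ℓ}

theorem reduction_apply (a : 𝓞 K) : reduction K ℓ a = 1 ⊗ₜ a := rfl

theorem adjoin_reduction_image_eq_top {s : Set (𝓞 K)} (hs : Algebra.adjoin ℤ s = ⊤) :
    Algebra.adjoin (ZMod ℓ) (reduction K ℓ '' s) = ⊤ :=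
  Algebra.TensorProduct.adjoin_one_tmul_image_eq_top s hs

theorem reduction_surjective : Function.Surjective (reduction K ℓ) := fun z => by
  induction z using TensorProduct.induction_on with
  | zero => exact ⟨0, map_zero _⟩
  | tmul c a =>
    obtain ⟨n, rfl⟩ := ZMod.intCast_surjective c
    refine ⟨n • a, ?_⟩
    rw [reduction_apply, TensorProduct.tmul_smul, TensorProduct.smul_tmul', zsmul_one]
  | add x y hx hy =>
    obtain ⟨a, rfl⟩ := hx
    obtain ⟨b, rfl⟩ := hy
    exact ⟨a + b, map_add _ _ _⟩

variable [NumberField K]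

theorem finrank_kappa : Module.finrank (ZMod ℓ) (Kappa K ℓ) = Module.finrank ℚ K := by
  rw [Module.finrank_baseChange, RingOfIntegers.rank]

theorem ker_reduction : RingHom.ker (reduction K ℓ) = Ideal.span {(ℓ : 𝓞 K)} := by
  have hle : Ideal.span {(ℓ : 𝓞 K)} ≤ RingHom.ker (reduction K ℓ) := by
    rw [Ideal.span_le, Set.singleton_subset_iff, SetLike.mem_coe, RingHom.mem_ker, map_natCast,
      ← map_natCast (algebraMap (ZMod ℓ) (Kappa K ℓ)), ZMod.natCast_self, map_zero]
  refine le_antisymm (fun x hx => ?_) hle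
  have := finite_quotient_span_natCast ℓ K
  let π : 𝓞 K ⧸ Ideal.span {(ℓ : 𝓞 K)} →+* Kappa K ℓ := Ideal.Quotient.lift _ (reduction K ℓ) hle
  have hπ : Function.Surjective π :=
    Ideal.Quotient.lift_surjective_of_surjective _ _ reduction_surjective
  have hcard : Nat.card (𝓞 K ⧸ Ideal.span {(ℓ : 𝓞 K)}) = Nat.card (Kappa K ℓ) := by
    rw [Module.natCard_eq_pow_finrank (K := ZMod ℓ) (V := Kappa K ℓ), finrank_kappa, Nat.card_zmod,
      natCard_quotient_span_natCast]
  have : Finite (Kappa K ℓ) := Module.finite_of_finite (ZMod ℓ)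
  rw [← Ideal.Quotient.eq_zero_iff_mem]
  exact (hπ.bijective_of_nat_card_le hcard.le).injective (by rw [map_zero]; exact hx)

theorem natCard_units_kappa :
    Nat.card (Kappa K ℓ)ˣ = Nat.card (𝓞 K ⧸ Ideal.span {(ℓ : 𝓞 K)})ˣ := by
  rw [← ker_reduction]
  exact Nat.card_congr (Units.mapEquiv
    (RingHom.quotientKerEquivOfSurjective reduction_surjective).toMulEquiv).symm.toEquiv

end Reduction

section Model

variable {K : Type*} [Field K] {ℓ : ℕ} [Fact ℓ.Prime]
  {E : Type*} [Field E] {q : ℕ} {w w' : 𝓞 K} {s : 𝓞 E}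

theorem exists_kappa_algEquiv [NumberField K] [NumberField E] [Algebra E K]
    (hE : Module.finrank E K = 2) (hs : algebraMap (𝓞 E) (𝓞 K) s = w + w') (hmul : w * w' = q)
    (htop : Algebra.adjoin ℤ {w, w'} = ⊤) :
    ∃ e : WeilAlgebra (q : ZMod ℓ) (reduction E ℓ s) ≃ₐ[ZMod ℓ] Kappa K ℓ,
      e ω = reduction K ℓ w ∧ e (star ω) = reduction K ℓ w' := by
  refine exists_weilAlgebra_algEquiv
    (Algebra.TensorProduct.map (AlgHom.id (ZMod ℓ) _) (algebraMap (𝓞 E) (𝓞 K)).toIntAlgHom)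
    ?_ ?_ ?_ ?_
  · rw [← map_add, ← hs]
    exact Algebra.TensorProduct.map_tmul ..
  · rw [← map_mul, hmul, map_natCast, map_natCast]
  · rw [← Set.image_pair, adjoin_reduction_image_eq_top htop]
  · rw [finrank_kappa, finrank_kappa, ← Module.finrank_mul_finrank ℚ E K, hE,
      mul_comm]

variable {e : WeilAlgebra (q : ZMod ℓ) (reduction E ℓ s) ≃ₐ[ZMod ℓ] Kappa K ℓ}

theorem adjoin_reduction_trace_eq_top (htop : Algebra.adjoin ℤ {w, w'} = ⊤)
    (hω : e ω = reduction K ℓ w) (hstar : e (star ω) = reduction K ℓ w') :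
    Algebra.adjoin (ZMod ℓ) {reduction E ℓ s} = ⊤ := by
  refine adjoin_eq_top_of_adjoin_omega_star_omega (q := (q : ZMod ℓ))
    (Subalgebra.map_injective (f := (e : _ →ₐ[ZMod ℓ] Kappa K ℓ)) e.injective ?_)
  rw [AlgHom.map_adjoin, Set.image_pair, Algebra.map_top, (AlgHom.range_eq_top _).mpr e.surjective]
  exact (congrArg _ (by rw [Set.image_pair, ← hω, ← hstar]; rfl)).trans
    (adjoin_reduction_image_eq_top htop)

end Model

section ConjSymplectic

variable {K : Type*} [Field K] [NumberField K] {ℓ : ℕ} [Fact ℓ.Prime] {R : Type*} [CommRing R]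
  [Algebra (ZMod ℓ) R] {q : ZMod ℓ} {s : R} {e : WeilAlgebra q s ≃ₐ[ZMod ℓ] Kappa K ℓ}

theorem symm_reduction_smul {w : 𝓞 K} {ι : K ≃ₐ[ℚ] K}
    (htop : Algebra.adjoin ℤ {w, ι • w} = ⊤) (hw : ι • ι • w = w)
    (hω : e ω = reduction K ℓ w) (hstar : e (star ω) = reduction K ℓ (ι • w)) (a : 𝓞 K) :
    e.symm (reduction K ℓ (ι • a)) = star (e.symm (reduction K ℓ a)) := by
  let g : 𝓞 K →+* WeilAlgebra q s := (e.symm : Kappa K ℓ →+* _).comp (reduction K ℓ)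
  have hgw : g w = ω := (e.symm_apply_eq).mpr hω.symm
  have hgw' : g (ι • w) = star ω := (e.symm_apply_eq).mpr hstar.symm
  have h : (g.comp (MulSemiringAction.toRingHom _ (𝓞 K) ι)).toIntAlgHom =
      ((starRingEnd (WeilAlgebra q s)).comp g).toIntAlgHom := by
    refine AlgHom.ext_of_adjoin_eq_top htop ?_
    rintro _ (rfl | rfl)
    · exact hgw'.trans (congrArg star hgw).symm
    · exact (congrArg g hw).trans (hgw.trans ((congrArg star hgw').trans (star_star _)).symm)
  exact congr($h a)

theorem isConjSymplectic_iff {ι : K ≃ₐ[ℚ] K} (hι : ∀ φ : K →+* ℂ, ComplexEmbedding.IsConj φ ι)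
    (hs : Algebra.adjoin (ZMod ℓ) {s} = ⊤)
    (he : ∀ a, e.symm (reduction K ℓ (ι • a)) = star (e.symm (reduction K ℓ a)))
    {B : LinearMap.BilinForm (ZMod ℓ) (Kappa K ℓ)} :
    IsConjSymplectic K ℓ B ↔ ∃ μ : R →ₗ[ZMod ℓ] ZMod ℓ, (mulForm μ).Nondegenerate ∧
      B = LinearMap.BilinForm.congr e.toLinearEquiv (form μ) := by
  constructor
  · rintro ⟨halt, hnondeg, ι', hι', hadj⟩
    obtain ⟨φ⟩ : Nonempty (K →+* ℂ) := inferInstance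
    obtain rfl : ι' = ι := (hι' φ).ext (hι φ)
    let B' := LinearMap.BilinForm.congr e.symm.toLinearEquiv B
    have hB' (x y : WeilAlgebra q s) : B' x y = B (e x) (e y) := rfl
    obtain ⟨μ, hμ⟩ := exists_eq_form (B := B') (fun x => halt (e x)) hs fun z x y => by
      obtain ⟨a, ha⟩ := reduction_surjective (e z)
      have hz : e (star z) = reduction K ℓ (ι' • a) := by
        rw [← e.eq_symm_apply, he, ha, e.symm_apply_apply]
      rw [hB', hB', map_mul e, map_mul e, hz, ← ha]
      exact hadj a (e x) (e y)
    have hB'_nondeg : B'.Nondegenerate :=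
      (LinearMap.BilinForm.nondegenerate_congr_iff e.symm.toLinearEquiv).mpr hnondeg
    refine ⟨μ, form_nondegenerate_iff.mp (hμ ▸ hB'_nondeg), hμ ▸ ?_⟩
    exact ((LinearMap.BilinForm.congr e.toLinearEquiv).apply_symm_apply B).symm
  · rintro ⟨μ, hμ, rfl⟩
    refine ⟨fun x => form_isAlt μ _, ?_, ι, hι, fun a x y => ?_⟩
    · exact (LinearMap.BilinForm.nondegenerate_congr_iff e.toLinearEquiv).mpr
        (form_nondegenerate_iff.mpr hμ)
    · have h := form_mul_left μ (e.symm (reduction K ℓ a)) (e.symm x) (e.symm y)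
      rwa [← he, ← map_mul, ← map_mul] at h

end ConjSymplectic

section Frobenius

variable {K : Type*} [Field K] {ℓ : ℕ} [Fact ℓ.Prime]
  {E : Type*} [Field E] [NumberField E] {q : ℕ} {w : 𝓞 K} {s : 𝓞 E}
  {e : WeilAlgebra (q : ZMod ℓ) (reduction E ℓ s) ≃ₐ[ZMod ℓ] Kappa K ℓ}
  {μ : Kappa E ℓ →ₗ[ZMod ℓ] ZMod ℓ}

theorem exists_isSymplecticBasis (hE : Module.finrank ℚ E = 2) (hμ : (mulForm μ).Nondegenerate) :
    ∃ b, IsSymplecticBasis (LinearMap.BilinForm.congr e.toLinearEquiv (form μ)) b := by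
  obtain ⟨b, hb⟩ := exists_basis_form_eq_J (a := -algebraMap (ZMod ℓ) _ (q : ZMod ℓ))
    (b := reduction E ℓ s) (finrank_kappa.trans hE) hμ
  refine ⟨b.map e.toLinearEquiv, fun i j => ?_⟩
  rw [← hb, LinearMap.BilinForm.congr_apply, Module.Basis.map_apply, Module.Basis.map_apply,
    LinearEquiv.symm_apply_apply, LinearEquiv.symm_apply_apply]

theorem exists_isFrobMatrix [NumberField K] (hE : Module.finrank ℚ E = 2) (hq : (q : ZMod ℓ) ≠ 0)
    (hs : Algebra.adjoin (ZMod ℓ) {reduction E ℓ s} = ⊤) (hμ : (mulForm μ).Nondegenerate)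
    (hω : e ω = reduction K ℓ w) {b : Module.Basis (Fin 2 ⊕ Fin 2) (ZMod ℓ) (Kappa K ℓ)}
    (hb : IsSymplecticBasis (LinearMap.BilinForm.congr e.toLinearEquiv (form μ)) b) :
    ∃ γ ∈ GSpMult (ZMod ℓ) (q : ZMod ℓ), IsFrobMatrix (w : K) b γ ∧
      nuF ℓ q γ = ℓ ^ 2 * Nat.card (𝓞 E ⧸ Ideal.span {(ℓ : 𝓞 E)})ˣ /
        Nat.card (𝓞 K ⧸ Ideal.span {(ℓ : 𝓞 K)})ˣ := by
  obtain ⟨u, hu⟩ := isUnit_omega (s := reduction E ℓ s) hq.isUnit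
  let b' := b.map e.symm.toLinearEquiv
  have hb' (i j) : form μ (b' i) (b' j) = J (ZMod ℓ) i j := hb i j
  let γ := (glEquiv b').symm (mulLeftEquiv (ZMod ℓ) u)
  have hγ : glEquiv b' γ = mulLeftEquiv (ZMod ℓ) u := (glEquiv b').apply_symm_apply _
  refine ⟨γ, (mem_GSpMult_iff hb').mpr (hγ ▸ mulLeftEquiv_mem_similitudes hu), ⟨w, rfl, ?_⟩, ?_⟩
  · rw [← toMatrix_glEquiv b' γ, hγ]
    ext i j
    rw [LinearMap.toMatrix_apply, LinearMap.toMatrix_apply]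
    have h : e (u * e.symm (b j)) = reduction K ℓ w * b j := by
      rw [map_mul, hu, hω, e.apply_symm_apply]
    exact congr(b.repr $h i)
  · rw [nuF_eq_of_glEquiv_eq (finrank_kappa.trans hE) hq hs hμ hb' hu hγ, natCard_units_kappa,
      Nat.card_congr (Units.mapEquiv e.toMulEquiv).toEquiv, natCard_units_kappa]

end Frobenius

end WeilSurface

end

open WeilSurface in
theorem mainTheorem3_general {q : ℕ} {f : Polynomial ℤ} {K : Type*} [Field K] [NumberField K]
    [IsGalois ℚ K] {ϖ : K} (hf : IsWeilQuartic q f)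
    (hirr : Irreducible (f.map (Int.castRingHom ℚ))) (hϖ : IsRootField f K ϖ)
    (hmax : IsMaximalWeil K ϖ) {ℓ : ℕ} [Fact ℓ.Prime] (hℓ : ¬ ℓ ∣ q) :
    (∃ B : LinearMap.BilinForm (ZMod ℓ) (Kappa K ℓ), IsConjSymplectic K ℓ B) ∧
    ∀ B : LinearMap.BilinForm (ZMod ℓ) (Kappa K ℓ), IsConjSymplectic K ℓ B →
      (∃ b, IsSymplecticBasis B b) ∧
      ∀ b, IsSymplecticBasis B b →
        ∃ γ ∈ GSpMult (ZMod ℓ) (q : ZMod ℓ), IsFrobMatrix ϖ b γ ∧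
          (nuF ℓ q γ : ℂ) = nuK K ℓ := by
  have hK : Module.finrank ℚ K = 4 := (hϖ.finrank_eq hf.1 hirr).trans hf.2.1
  have := hϖ.isTotallyComplex hf hirr
  have : IsAbelianGalois ℚ K := isAbelianGalois_of_finrank_eq_prime_sq (p := 2) hK
  have : IsAbelianGalois ℚ (maximalRealSubfield K) := .tower_bot ℚ _ K
  have hE : Module.finrank ℚ (maximalRealSubfield K) = 2 := by
    have := two_mul_finrank_maximalRealSubfield K
    lia
  obtain ⟨ι, hι⟩ := exists_isConj K
  obtain ⟨w, rfl, htop⟩ := hmax.exists_adjoin_eq_top hι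
  obtain ⟨s, hs⟩ := exists_algebraMap_eq_add_smul hι w
  obtain ⟨e, hω, hstar⟩ := exists_kappa_algEquiv (ℓ := ℓ)
    (Algebra.IsQuadraticExtension.finrank_eq_two _ _) hs (hϖ.mul_smul_eq hf hι) htop
  have hgen := adjoin_reduction_trace_eq_top htop hω hstar
  have hiff {B} := isConjSymplectic_iff (B := B) hι hgen
    (symm_reduction_smul htop (smul_smul_self_of_isConj hι w) hω hstar)
  obtain ⟨μ₀, hμ₀⟩ := exists_mulForm_nondegenerate (IsAdjoinRootMonic.mkOfAdjoinEqTop' hgen)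
  refine ⟨⟨_, hiff.mpr ⟨μ₀, hμ₀, rfl⟩⟩, fun B hB => ?_⟩
  obtain ⟨μ, hμ, rfl⟩ := hiff.mp hB
  refine ⟨exists_isSymplecticBasis hE hμ, fun b hb => ?_⟩
  have hq : (q : ZMod ℓ) ≠ 0 := by rwa [Ne, ZMod.natCast_eq_zero_iff]
  obtain ⟨γ, hγ, hfrob, hnu⟩ := exists_isFrobMatrix hE hq hgen hμ hω hb
  refine ⟨γ, hγ, hfrob, ?_⟩
  have hℓ0 : (ℓ : ℂ) ≠ 0 := by exact_mod_cast (Fact.out : ℓ.Prime).ne_zero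
  rw [hnu, nuK_eq imagChars_eq, hE, hK]
  push_cast
  field_simp

open WeilSurface in
theorem mainTheorem3 (p q : ℕ) (hp : p.Prime) (f : Polynomial ℤ)
    (K : Type*) [Field K] [NumberField K] [IsGalois ℚ K] (ϖ : K)
    (hf : IsAdmissible p q f K ϖ) (ℓ : ℕ) [Fact ℓ.Prime] (hℓ : ℓ ≠ p) :
    -- the data entering the definition of `ν_ℓ(f)` exist
    (∃ B : LinearMap.BilinForm (ZMod ℓ) (Kappa K ℓ), IsConjSymplectic K ℓ B) ∧
    -- and the identity holds for every choice of them
    ∀ B : LinearMap.BilinForm (ZMod ℓ) (Kappa K ℓ), IsConjSymplectic K ℓ B →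
      (∃ b, IsSymplecticBasis B b) ∧
      ∀ b, IsSymplecticBasis B b →
        ∃ γ ∈ GSpMult (ZMod ℓ) (q : ZMod ℓ), IsFrobMatrix ϖ b γ ∧
          (nuF ℓ q γ : ℂ) = nuK K ℓ :=
  mainTheorem3_general hf.weil hf.irreducible hf.rootField hf.maximal
    (hf.not_dvd hp Fact.out hℓ)
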